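/- Let $p$ be prime, $q=p^m$, and let $\operatorname{tr}$ be the absolute trace of $\mathbb F_q/\mathbb F_p$. On $\mathbb F_q^{2n}$ put $\langle(\boldsymbol a|\boldsymbol b),(\boldsymbol u|\boldsymbol v)\rangle_{\rm T}=\sum_{i}\operatorname{tr}(a_iv_i-b_iu_i)$ and $\operatorname{swt}((\boldsymbol a|\boldsymbol b))=|\{i:(a_i,b_i)\neq(0,0)\}|$. For $S\subseteq\mathbb F_q^{2n}$ let $\operatorname{swt}(S)$ be the minimum of $\operatorname{swt}(\boldsymbol x)$ over $\boldsymbol x\in S\setminus\{\boldsymbol 0\}$ and $d_{\rm S}(S)$ the minimum of $\operatorname{swt}(\boldsymbol x-\boldsymbol y)$ over distinct $\boldsymbol x,\boldsymbol y\in S$; a minimum over the empty set is taken to be $n$. A stabilizer code of length $N$ is a non-zero subspace $\mathcal Q\subseteq(\mathbb C^q)^{\otimes N}$ that is the joint fixed space of a group of operators of the form $c\,X(\boldsymbol a)Z(\boldsymbol b)$ with $|c|=1$ and $\boldsymbol a,\boldsymbol b\in\mathbb F_q^N$, where $X(\boldsymbol a)Z(\boldsymbol b)|\boldsymbol y\rangle=e^{2\pi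 i\operatorname{tr}(\boldsymbol b\cdot\boldsymbol y)/p}|\boldsymbol y+\boldsymbol a\rangle$. Its minimum distance $d(\mathcal Q)$ is the largest $d\le N$ such that, for every operator $E$ acting on at most $d-1$ tensor factors, there is a scalar $c$ with $\langle u|E|v\rangle=c\,\langle u|v\rangle$ for all $u,v\in\mathcal Q$; if $\dim\mathcal Q=1$, it is moreover required that $c=q^{-N}\operatorname{Tr}E$. The code is an $[\![N,k',d]\!]_q$ code if $\dim\mathcal Q=q^{k'}$ and $d=d(\mathcal Q)$; here $k'$ need not be an integer. **Theorem.** Let $C\subseteq\mathbb F_q^{2n}$ be an additive (i.e. $\mathbb F_p$-linear) code with $|C|=p^k$, and let $C^{\perp_{\rm T}}$ be its dual with respect to $\langle\cdot,\cdot\rangle_{\rm T}$. Then $k-\dim_{\mathbb F_p}(C\cap C^{\perp_{\rm T}})=2e$ for an integer $e\ge0$, and there is an $[\![n+\lceil e/m\rceil,\;n-(k-e)/m,\;d(\mathcal Q)]\!]_q$ stabilizer code $\mathcal Q$ with the following properties. 1. If $C^{\perp_{\rm T}}\not\subseteq C$ (equivalently $\dim\mathcal Q>1$), then $$d(\mathcal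 Q)\ \ge\ \min\{\operatorname{swt}(C^{\perp_{\rm T}}\setminus(C\cap C^{\perp_{\rm T}})),\ \operatorname{swt}((C+C^{\perp_{\rm T}})\setminus C)+1\}.$$ 2. In all cases $$\min\{\operatorname{swt}(C^{\perp_{\rm T}}\setminus(C\cap C^{\perp_{\rm T}})),\ \operatorname{swt}((C+C^{\perp_{\rm T}})\setminus C)+1\}\ \ge\ \min\{d_{\rm S}(C^{\perp_{\rm T}}),\ d_{\rm S}(C+C^{\perp_{\rm T}})+1\}.$$ 3. If $C^{\perp_{\rm T}}\subseteq C$ (equivalently $\dim\mathcal Q=1$) and $m\mid e$, then $d(\mathcal Q)\ge\min\{d_{\rm S}(C^{\perp_{\rm T}}),\ d_{\rm S}(C+C^{\perp_{\rm T}})+1\}$. 4. In all cases $d(\mathcal Q)\le\operatorname{swt}(C^{\perp_{\rm T}}\setminus(C\cap C^{\perp_{\rm T}}))$. -/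

import Mathlib

open scoped Matrix

noncomputable section

namespace TraceSymp

section Classical

variable {F : Type*} [Field F] [DecidableEq F]

/-- Symplectic weight of `(a|b)`: the number of positions `i` with `(a i, b i) ≠ (0, 0)`. -/
def swt {n : ℕ} (c : (Fin n → F) × (Fin n → F)) : ℕ :=
  (Finset.univ.filter fun i => (c.1 i, c.2 i) ≠ (0, 0)).card

open Classical in
/-- Minimum symplectic weight of the non-zero elements of `S`; it is `n` if there are none. -/
def minSwt {n : ℕ} (S : Set ((Fin n → F) × (Fin n → F))) : ℕ :=
  if (S \ {0}).Nonempty then sInf (swt '' (S \ {0})) else n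

open Classical in
/-- Symplectic minimum distance of `S`; it is `n` if `S` has no two distinct elements. -/
def symDist {n : ℕ} (S : Set ((Fin n → F) × (Fin n → F))) : ℕ :=
  if S.Nontrivial then sInf {w | ∃ x ∈ S, ∃ y ∈ S, x ≠ y ∧ w = swt (x - y)} else n

end Classical

section Form

variable (p : ℕ) [Fact p.Prime] {F : Type*} [Field F] [Algebra (ZMod p) F]

/-- The trace-symplectic inner product `∑ i, tr (a i * v i - b i * u i)` of `(a|b)` and
`(u|v)`, where `tr` is the absolute trace. -/
def traceSymp {n : ℕ} (c d : (Fin n → F) × (Fin n → F)) : ZMod p :=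
  ∑ i, Algebra.trace (ZMod p) F (c.1 i * d.2 i - c.2 i * d.1 i)

/-- The trace-symplectic dual of an additive code. -/
def traceDual {n : ℕ} (C : Submodule (ZMod p) ((Fin n → F) × (Fin n → F))) :
    Submodule (ZMod p) ((Fin n → F) × (Fin n → F)) where
  carrier := {d | ∀ c ∈ C, traceSymp p c d = 0}
  zero_mem' := by
    intro c _
    simp [traceSymp]
  add_mem' := by
    intro x y hx hy c hc
    have h : traceSymp p c (x + y) = traceSymp p c x + traceSymp p c y := by
      simp only [traceSymp, ← Finset.sum_add_distrib, ← map_add]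
      refine Finset.sum_congr rfl fun i _ => ?_
      congr 1
      simp only [Prod.fst_add, Prod.snd_add, Pi.add_apply]
      ring
    rw [h, hx c hc, hy c hc, add_zero]
  smul_mem' := by
    intro r x hx c hc
    have h : traceSymp p c (r • x) = r * traceSymp p c x := by
      simp only [traceSymp, Finset.mul_sum]
      refine Finset.sum_congr rfl fun i _ => ?_
      rw [← smul_eq_mul (a := r), ← map_smul]
      congr 1
      simp only [Prod.smul_fst, Prod.smul_snd, Pi.smul_apply, mul_smul_comm, smul_sub]
    rw [h, hx c hc, mul_zero]

end Form

section Quantum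

/-- The state space `(ℂ^q)^{⊗N}` in its standard basis: the basis vectors of `ℂ^q` are labelled
by the `q` elements of `F`, those of the tensor product by the words `x : Fin N → F`. Its
Hermitian inner product is `star u ⬝ᵥ v`. -/
abbrev StateSpace (N : ℕ) (F : Type*) : Type _ := (Fin N → F) → ℂ

/-- Linear operators on the state space, as matrices in the standard basis. -/
abbrev Operator (N : ℕ) (F : Type*) : Type _ := Matrix (Fin N → F) (Fin N → F) ℂ

section Stabilizer

variable (p : ℕ) [Fact p.Prime] {F : Type*} [Field F] [Fintype F] [DecidableEq F]
  [Algebra (ZMod p) F]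

/-- The error operator `X(a) Z(b)`, which maps the basis vector `|y⟩` to
`ω ^ tr (∑ i, b i * y i) |y + a⟩`, where `ω = exp (2πi/p)`. -/
def errorOp {N : ℕ} (a b : Fin N → F) : Operator N F :=
  Matrix.of fun x y =>
    if x = y + a then
      (ZMod.stdAddChar (Algebra.trace (ZMod p) F (∑ i, b i * y i)) : ℂ)
    else 0

/-- A stabilizer code: a non-zero subspace that is the joint fixed space of a group of
operators each of which is, up to a phase, an error operator `X(a) Z(b)`. -/
def IsStabilizerCode {N : ℕ} (Q : Submodule ℂ (StateSpace N F)) : Prop :=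
  Q ≠ ⊥ ∧
    ∃ S : Subgroup (Operator N F)ˣ,
      (∀ g ∈ S, ∃ (c : ℂ) (a b : Fin N → F),
        ‖c‖ = 1 ∧ (g : Operator N F) = c • errorOp p a b) ∧
      ∀ v : StateSpace N F, v ∈ Q ↔ ∀ g ∈ S, (g : Operator N F) *ᵥ v = v

end Stabilizer

variable {F : Type*} [Fintype F] [DecidableEq F]

/-- `E` acts only on the tensor factors in `T`: `E = A ⊗ 1` with `A` an arbitrary operator on
the factors in `T` and the identity on the others. -/
def ActsOn {N : ℕ} (T : Finset (Fin N)) (E : Operator N F) : Prop :=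
  ∃ A : Matrix (T → F) (T → F) ℂ, ∀ x y : Fin N → F,
    E x y = if ∀ i, i ∉ T → x i = y i then A (fun i => x i) (fun i => y i) else 0

/-- Every error acting on at most `d - 1` of the tensor factors is detected by `Q` or has no
effect on it (Knill-Laflamme condition: the compression of `E` to `Q` is a scalar). This is no
condition for one-dimensional codes, for which, as usual, the code is required to be pure: the
scalar has to be the normalized trace of `E`. -/
def DetectsBelow {N : ℕ} (Q : Submodule ℂ (StateSpace N F)) (d : ℕ) : Prop :=
  ∀ T : Finset (Fin N), T.card < d → ∀ E : Operator N F, ActsOn T E →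
    ∃ c : ℂ,
      (∀ u ∈ Q, ∀ v ∈ Q, star u ⬝ᵥ (E *ᵥ v) = c * (star u ⬝ᵥ v)) ∧
      (Module.finrank ℂ Q = 1 → c = E.trace / (Fintype.card F : ℂ) ^ N)

/-- The minimum distance of a quantum code of length `N`: the largest `d ≤ N` such that
every error acting on at most `d - 1` tensor factors is detected or has no effect. -/
def qDist {N : ℕ} (Q : Submodule ℂ (StateSpace N F)) : ℕ :=
  sSup {d | d ≤ N ∧ DetectsBelow Q d}

end Quantum

end TraceSymp

end

/-! Let `R` be the radical `C ⊓ traceDual p C`. The form on `C / R` is symplectic, which makes its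
dimension `2e` even. With `r = ⌈e/m⌉`, the space of words of length `r` has `m * r = e + f`
hyperbolic pairs. Mapping `C / R` onto the span of `e` of them with the sign reversed gives `φ`, and
half of the other `f` pairs spans a Lagrangian `L` of the complement of the image
(`exists_isAntiIsometry`). The words `(c | φ c + l)` form a self-orthogonal code `S` of length `n +
r` and dimension `k + f`, because the two halves of the form cancel.

A self-orthogonal code carries phases that turn its error operators into a group (`exists_isPhase`).
The average of that group is a projector whose trace gives the dimension of the fixed space. The
errors that are not detected are the words of the dual outside `S`, together with the non-zero words
of `S` when `S` is self-dual (`IsPhase.detectsBelow` and the two `not_detectsBelow` lemmas).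

The dual of `S` consists of the words `(c + d | φ c + l)` with `d` in the dual of `C`
(`IsAntiIsometry.exists_of_mem_traceDual`). Such a word outside `S` either has tail zero, and then
its head lies in the dual of `C`, or its tail adds at least one to the weight. This is the lower
bound; the words `(d | 0)` give the upper bound.

If the dual of `C` lies in `C`, the upper bound is the default value `n`, and `S` must contain a
non-zero word of weight at most `n`. A non-zero `(d | 0)` or `(0 | l)` serves. Neither exists only
when `C` is the full space and `m * r = e`; this case has its own construction. -/

open scoped Matrix

noncomputable section

namespace TraceSymp

/-! ### Hyperbolic families of alternating forms. -/

section Hyperbolic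

variable {K V : Type*} [Field K] [AddCommGroup V] [Module K V]

/-- A family of pairwise orthogonal hyperbolic pairs `(u i, v i)` of a bilinear form. -/
structure IsHyperbolic {ι : Type*} [DecidableEq ι] (B : LinearMap.BilinForm K V) (u v : ι → V) :
    Prop where
  uu : ∀ i j, B (u i) (u j) = 0
  vv : ∀ i j, B (v i) (v j) = 0
  uv : ∀ i j, B (u i) (v j) = if i = j then 1 else 0

/-- The coordinates of a vector with respect to a hyperbolic family. -/
def hypCoord {ι : Type*} (B : LinearMap.BilinForm K V) (u v : ι → V) :
    V →ₗ[K] (ι → K) × (ι → K) :=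
  (LinearMap.pi fun i => B.flip (v i)).prod (LinearMap.pi fun i => B (u i))

@[simp] theorem hypCoord_fst {ι : Type*} (B : LinearMap.BilinForm K V) (u v : ι → V) (x : V)
    (i : ι) : (hypCoord B u v x).1 i = B x (v i) := rfl

@[simp] theorem hypCoord_snd {ι : Type*} (B : LinearMap.BilinForm K V) (u v : ι → V) (x : V)
    (i : ι) : (hypCoord B u v x).2 i = B (u i) x := rfl

/-- The linear combination of a hyperbolic family with given coordinates. -/
def hypComb {ι : Type*} [Fintype ι] (u v : ι → V) : (ι → K) × (ι → K) →ₗ[K] V :=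
  (Fintype.linearCombination K u).coprod (Fintype.linearCombination K v)

theorem hypComb_apply {ι : Type*} [Fintype ι] (u v : ι → V) (a : (ι → K) × (ι → K)) :
    hypComb u v a = ∑ i, a.1 i • u i + ∑ i, a.2 i • v i := rfl

section

variable {ι : Type*} [DecidableEq ι] {B : LinearMap.BilinForm K V} {u v : ι → V}

theorem IsHyperbolic.vu (h : IsHyperbolic B u v) (hB : B.IsAlt) (i j : ι) :
    B (v i) (u j) = if i = j then -1 else 0 := by
  rw [← hB.neg_eq, h.uv]
  by_cases hij : i = j
  · simp [hij]
  · simp [hij, Ne.symm hij]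

variable [Fintype ι]

theorem IsHyperbolic.coord_comb (h : IsHyperbolic B u v) (a : (ι → K) × (ι → K)) :
    hypCoord B u v (hypComb u v a) = a := by
  ext i
  · rw [hypCoord_fst]
    simp [hypComb_apply, h.vv, h.uv]
  · rw [hypCoord_snd]
    simp [hypComb_apply, h.uu, h.uv]

theorem IsHyperbolic.coord_surjective (h : IsHyperbolic B u v) :
    Function.Surjective (hypCoord B u v) := fun a => ⟨_, h.coord_comb a⟩

theorem IsHyperbolic.comb_injective (h : IsHyperbolic B u v) :
    Function.Injective (hypComb (K := K) u v) :=
  Function.LeftInverse.injective h.coord_comb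

theorem IsHyperbolic.card_le [FiniteDimensional K V] (h : IsHyperbolic B u v) :
    2 * Fintype.card ι ≤ Module.finrank K V := by
  have := LinearMap.finrank_le_finrank_of_injective h.comb_injective
  rw [Module.finrank_prod, Module.finrank_fintype_fun_eq_card] at this
  omega

theorem IsHyperbolic.apply_comb (h : IsHyperbolic B u v) (hB : B.IsAlt)
    (a b : (ι → K) × (ι → K)) :
    B (hypComb u v a) (hypComb u v b) = ∑ i, (a.1 i * b.2 i - a.2 i * b.1 i) := by
  simp [hypComb_apply, h.uu, h.vv, h.uv, h.vu hB, Finset.sum_add_distrib,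
    sub_eq_add_neg]

end

/-- Vectors with zero coordinates are orthogonal to the family, so a pair of them can be adjoined.
This is the step that a maximal family rules out. -/
theorem isHyperbolic_cons {e : ℕ} {B : LinearMap.BilinForm K V} {u v : Fin e → V} (hB : B.IsAlt)
    (h : IsHyperbolic B u v) {x y : V} (hx : hypCoord B u v x = 0) (hy : hypCoord B u v y = 0)
    (hxy : B x y = 1) :
    IsHyperbolic B (Fin.cons x u : Fin (e + 1) → V) (Fin.cons y v) := by
  have hx1 : ∀ i, B x (v i) = 0 := fun i => congrFun (congrArg Prod.fst hx) i
  have hx2 : ∀ i, B (u i) x = 0 := fun i => congrFun (congrArg Prod.snd hx) i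
  have hy1 : ∀ i, B y (v i) = 0 := fun i => congrFun (congrArg Prod.fst hy) i
  have hy2 : ∀ i, B (u i) y = 0 := fun i => congrFun (congrArg Prod.snd hy) i
  have hx3 : ∀ i, B x (u i) = 0 := fun i => by rw [← hB.neg_eq, hx2, neg_zero]
  have hy3 : ∀ i, B (v i) y = 0 := fun i => by rw [← hB.neg_eq, hy1, neg_zero]
  constructor <;> intro i j <;> refine Fin.cases ?_ (fun i => ?_) i <;>
    refine Fin.cases ?_ (fun j => ?_) j <;>
    simp [hx1, hx2, hx3, hy1, hy2, hy3, hxy, h.uu, h.vv, h.uv, hB.self_eq_zero, Fin.succ_ne_zero,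
      (Fin.succ_ne_zero _).symm]

/-- An alternating form has a hyperbolic family that splits off its radical. -/
theorem exists_isHyperbolic [FiniteDimensional K V] {B : LinearMap.BilinForm K V}
    (hB : B.IsAlt) :
    ∃ (e : ℕ) (u v : Fin e → V), IsHyperbolic B u v ∧
      LinearMap.ker (hypCoord B u v) = LinearMap.ker B := by
  classical
  let P : ℕ → Prop := fun e => ∃ u v : Fin e → V, IsHyperbolic B u v
  have hP0 : P 0 := ⟨0, 0, ⟨fun i => i.elim0, fun i => i.elim0, fun i => i.elim0⟩⟩
  have hb : ∀ e, P e → e ≤ Module.finrank K V := fun e ⟨u, v, h⟩ => by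
    have := h.card_le
    rw [Fintype.card_fin] at this
    omega
  obtain ⟨u, v, h⟩ : P (Nat.findGreatest P (Module.finrank K V)) :=
    Nat.findGreatest_spec (Nat.zero_le _) hP0
  refine ⟨_, u, v, h, le_antisymm (fun x hx => ?_) (fun x hx => ?_)⟩
  · rw [LinearMap.mem_ker] at hx ⊢
    -- The family has maximal size. If `B x y ≠ 0` for some `y` in its complement, `x` and a
    -- multiple of `y` would be one more pair.
    have hW : ∀ y, hypCoord B u v y = 0 → B x y = 0 := fun y hy => by
      by_contra hne
      have h1 : P (Nat.findGreatest P (Module.finrank K V) + 1) :=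
        ⟨_, _, isHyperbolic_cons hB h hx (y := (B x y)⁻¹ • y) (by simp [hy])
          (by simp [hne])⟩
      have := Nat.le_findGreatest (hb _ h1) h1
      omega
    ext y
    -- Removing its hyperbolic component puts an arbitrary `y` into the complement; `x` does not see
    -- that component.
    have h1 := hW (y - hypComb u v (hypCoord B u v y)) (by rw [map_sub, h.coord_comb, sub_self])
    have hx1 : ∀ i, B x (v i) = 0 := fun i => congrFun (congrArg Prod.fst hx) i
    have hx3 : ∀ i, B x (u i) = 0 := fun i => by
      rw [← hB.neg_eq, show B (u i) x = 0 from congrFun (congrArg Prod.snd hx) i, neg_zero]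
    rw [map_sub, sub_eq_zero] at h1
    rw [h1]
    simp [hypComb_apply, hx1, hx3]
  · rw [LinearMap.mem_ker] at hx ⊢
    have h1 : ∀ y, B x y = 0 := fun y => by rw [hx]; rfl
    ext i
    · exact h1 _
    · rw [hypCoord_snd, ← hB.neg_eq, h1]
      simp

theorem IsHyperbolic.finrank_eq [FiniteDimensional K V] {ι : Type*} [Fintype ι] [DecidableEq ι]
    {B : LinearMap.BilinForm K V} {u v : ι → V} (h : IsHyperbolic B u v)
    (hk : LinearMap.ker (hypCoord B u v) = LinearMap.ker B) :
    Module.finrank K V = Module.finrank K (LinearMap.ker B) + 2 * Fintype.card ι := by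
  have := LinearMap.finrank_range_add_finrank_ker (hypCoord B u v)
  rw [LinearMap.range_eq_top.2 h.coord_surjective, finrank_top, hk, Module.finrank_prod,
    Module.finrank_fintype_fun_eq_card] at this
  omega

/-- A vector and the combination with the same coordinates differ by an element of the radical,
which the form ignores. -/
theorem IsHyperbolic.apply_eq {ι : Type*} [Fintype ι] [DecidableEq ι]
    {B : LinearMap.BilinForm K V} {u v : ι → V} (hB : B.IsAlt) (h : IsHyperbolic B u v)
    (hk : LinearMap.ker (hypCoord B u v) = LinearMap.ker B) (x y : V) :
    B x y = ∑ i, ((hypCoord B u v x).1 i * (hypCoord B u v y).2 i -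
      (hypCoord B u v x).2 i * (hypCoord B u v y).1 i) := by
  have key : ∀ z, B (z - hypComb u v (hypCoord B u v z)) = 0 := fun z => by
    rw [← LinearMap.mem_ker, ← hk, LinearMap.mem_ker, map_sub, h.coord_comb, sub_self]
  rw [← h.apply_comb hB]
  have h1 := LinearMap.congr_fun (key x) y
  have h2 := LinearMap.congr_fun (key y) (hypComb u v (hypCoord B u v x))
  rw [map_sub, LinearMap.sub_apply, LinearMap.zero_apply, sub_eq_zero] at h1 h2
  rw [h1, ← hB.neg_eq, h2, hB.neg_eq]

end Hyperbolic

/-! ### The trace-symplectic form and duality of additive codes. -/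

section Form

variable (p : ℕ) [Fact p.Prime] {F : Type*} [Field F] [Algebra (ZMod p) F] {n : ℕ}

/-- The trace-symplectic inner product as a bilinear form. -/
def traceForm (F : Type*) [Field F] [Algebra (ZMod p) F] (n : ℕ) :
    LinearMap.BilinForm (ZMod p) ((Fin n → F) × (Fin n → F)) :=
  LinearMap.mk₂ (ZMod p) (traceSymp p)
    (fun x y z => by
      simp only [traceSymp, ← Finset.sum_add_distrib, ← map_add]
      refine Finset.sum_congr rfl fun i _ => congrArg _ ?_
      simp only [Prod.fst_add, Prod.snd_add, Pi.add_apply]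
      ring)
    (fun r x y => by
      simp only [traceSymp, Finset.smul_sum, ← map_smul]
      refine Finset.sum_congr rfl fun i _ => congrArg _ ?_
      simp only [Prod.smul_fst, Prod.smul_snd, Pi.smul_apply, smul_mul_assoc, smul_sub])
    (fun x y z => by
      simp only [traceSymp, ← Finset.sum_add_distrib, ← map_add]
      refine Finset.sum_congr rfl fun i _ => congrArg _ ?_
      simp only [Prod.fst_add, Prod.snd_add, Pi.add_apply]
      ring)
    (fun r x y => by
      simp only [traceSymp, Finset.smul_sum, ← map_smul]
      refine Finset.sum_congr rfl fun i _ => congrArg _ ?_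
      simp only [Prod.smul_fst, Prod.smul_snd, Pi.smul_apply, mul_smul_comm, smul_sub])

theorem traceForm_apply (x y : (Fin n → F) × (Fin n → F)) :
    traceForm p F n x y = traceSymp p x y := rfl

theorem traceForm_isAlt : (traceForm p F n).IsAlt := fun x => by
  simp [traceForm_apply, traceSymp, mul_comm]

theorem traceDual_eq_orthogonal (C : Submodule (ZMod p) ((Fin n → F) × (Fin n → F))) :
    traceDual p C = (traceForm p F n).orthogonal C := rfl

theorem mem_traceDual {C : Submodule (ZMod p) ((Fin n → F) × (Fin n → F))}
    {x : (Fin n → F) × (Fin n → F)} : x ∈ traceDual p C ↔ ∀ c ∈ C, traceForm p F n c x = 0 :=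
  Iff.rfl

variable [Fintype F]

theorem exists_trace_mul_ne_zero {a : F} (ha : a ≠ 0) :
    ∃ b : F, Algebra.trace (ZMod p) F (a * b) ≠ 0 := by
  by_contra! h
  exact ha ((traceForm_nondegenerate (ZMod p) F).1 a h)

-- Words supported in a single position and in one half isolate the coordinates of `x`, which are
-- then detected by the trace form of the field.
variable (F n) in
theorem traceForm_nondegenerate' : (traceForm p F n).Nondegenerate := by
  classical
  have hr : LinearMap.IsRefl (traceForm p F n) := fun x y => (traceForm_isAlt p).isRefl x y
  refine hr.nondegenerate_iff_separatingLeft.2 fun x hx => ?_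
  have key : ∀ (j : Fin n), x.1 j = 0 ∧ x.2 j = 0 := fun j => by
    constructor
    · by_contra hne
      obtain ⟨b, hb⟩ := exists_trace_mul_ne_zero p hne
      refine hb ?_
      rw [← hx (0, Pi.single j b), traceForm_apply, traceSymp,
        Finset.sum_eq_single j (fun i _ hi => by simp [hi]) (by simp)]
      simp
    · by_contra hne
      obtain ⟨b, hb⟩ := exists_trace_mul_ne_zero p hne
      refine hb ?_
      rw [← neg_eq_zero, ← hx (Pi.single j b, 0), traceForm_apply, traceSymp,
        Finset.sum_eq_single j (fun i _ hi => by simp [hi]) (by simp)]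
      simp
  ext j
  · exact (key j).1
  · exact (key j).2

theorem finrank_word {m : ℕ} (hF : Fintype.card F = p ^ m) :
    Module.finrank (ZMod p) ((Fin n → F) × (Fin n → F)) = 2 * (m * n) := by
  have h : Module.finrank (ZMod p) F = m := by
    have := Module.card_eq_pow_finrank (K := ZMod p) (V := F)
    rw [hF, ZMod.card] at this
    exact (Nat.pow_right_injective (Fact.out : p.Prime).two_le this).symm
  rw [Module.finrank_prod, Module.finrank_pi_fintype]
  simp [h]
  ring

theorem finrank_traceDual {m : ℕ} (hF : Fintype.card F = p ^ m)
    (C : Submodule (ZMod p) ((Fin n → F) × (Fin n → F))) :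
    Module.finrank (ZMod p) C + Module.finrank (ZMod p) (traceDual p C) = 2 * (m * n) := by
  rw [traceDual_eq_orthogonal, LinearMap.BilinForm.finrank_orthogonal (traceForm_nondegenerate' p F n),
    ← finrank_word p hF (n := n)]
  have := Submodule.finrank_le C
  omega

theorem traceDual_traceDual (C : Submodule (ZMod p) ((Fin n → F) × (Fin n → F))) :
    traceDual p (traceDual p C) = C :=
  LinearMap.BilinForm.orthogonal_orthogonal (traceForm_nondegenerate' p F n)
    (traceForm_isAlt p).isRefl C

/-- By biduality this reduces to the elementary fact that the dual of a sum is the intersection of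
the duals. It locates the heads of the words dual to the extended code. -/
theorem traceDual_inf_traceDual (C : Submodule (ZMod p) ((Fin n → F) × (Fin n → F))) :
    traceDual p (C ⊓ traceDual p C) = C ⊔ traceDual p C := by
  rw [← traceDual_traceDual p (C ⊔ traceDual p C)]
  congr 1
  apply le_antisymm
  · rintro x ⟨h1, h2⟩ c hc
    obtain ⟨a, ha, b, hb, rfl⟩ := Submodule.mem_sup.1 hc
    rw [← traceForm_apply, map_add, LinearMap.add_apply]
    change traceForm p F n a x + _ = 0
    rw [(mem_traceDual p).1 h2 a ha, zero_add, (traceForm_isAlt p).isRefl _ _ (hb x h1)]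
  · intro x hx
    refine ⟨?_, fun c hc => hx c (Submodule.mem_sup_left hc)⟩
    rw [SetLike.mem_coe, ← traceDual_traceDual p C]
    exact fun c hc => hx c (Submodule.mem_sup_right hc)

end Form

/-! ### Phases that trivialize symmetric cocycles. -/

section Phase

variable {p : ℕ} [Fact p.Prime]

theorem zmod_two_eq_zero_or_one : ∀ z : ZMod 2, z = 0 ∨ z = 1 := by decide

/-- The character `j ↦ exp (2πij/p)` is the coboundary of a phase on the prime field, when
evaluated at products. -/
theorem exists_quadratic_phase (p : ℕ) [Fact p.Prime] :
    ∃ ψ : ZMod p → ℂ, (∀ x, ‖ψ x‖ = 1) ∧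
      ∀ x y, ψ (x + y) = ψ x * ψ y * ZMod.stdAddChar (x * y) := by
  by_cases hp : p = 2
  · subst hp
    have h1 : (ZMod.stdAddChar (1 : ZMod 2) : ℂ) = -1 := by
      have := ZMod.stdAddChar_coe (N := 2) 1
      rw [Int.cast_one] at this
      rw [this, ← Complex.exp_pi_mul_I]
      congr 1
      push_cast
      ring
    -- Halving is impossible for `p = 2`. The character is `-1` at `1`, and `I * I * (-1) = 1` is
    -- the only relation to satisfy beyond trivial ones.
    refine ⟨fun x => if x = 0 then 1 else Complex.I, fun x => ?_, fun x y => ?_⟩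
    · dsimp only
      split_ifs <;> simp
    · have h3 : (1 : ZMod 2) + 1 = 0 := rfl
      rcases zmod_two_eq_zero_or_one x with rfl | rfl <;>
        rcases zmod_two_eq_zero_or_one y with rfl | rfl <;> simp [h1, h3]
  -- For odd `p`, polarization of `x ^ 2 / 2` gives `x * y`.
  · refine ⟨fun x => ZMod.stdAddChar (2⁻¹ * x ^ 2), fun x => by simp, fun x y => ?_⟩
    have h2 : (2 : ZMod p) ≠ 0 := by
      intro h
      have h3 : ((2 : ℕ) : ZMod p) = 0 := by exact_mod_cast h
      rw [ZMod.natCast_eq_zero_iff] at h3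
      exact hp ((Nat.prime_dvd_prime_iff_eq Fact.out Nat.prime_two).1 h3)
    have h3 : 2⁻¹ * (x + y) ^ 2 = 2⁻¹ * x ^ 2 + 2⁻¹ * y ^ 2 + x * y := by
      linear_combination (x * y) * (mul_inv_cancel₀ h2)
    dsimp only
    rw [h3, AddChar.map_add_eq_mul, AddChar.map_add_eq_mul]

/-- The exponential of a symmetric bilinear form is the coboundary of a phase. -/
theorem exists_phase_of_symm {V : Type*} [AddCommGroup V] [Module (ZMod p) V]
    [FiniteDimensional (ZMod p) V] (b : LinearMap.BilinForm (ZMod p) V)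
    (hb : ∀ x y, b x y = b y x) :
    ∃ c : V → ℂ, (∀ x, ‖c x‖ = 1) ∧
      ∀ x y, c (x + y) = c x * c y * ZMod.stdAddChar (b x y) := by
  obtain ⟨ψ, hψ1, hψ⟩ := exists_quadratic_phase p
  let B := Module.finBasis (ZMod p) V
  -- `l` is the strictly upper triangular part of the Gram matrix, so `b` is `l`, plus its
  -- transpose, plus a diagonal form. No division by two is needed off the diagonal.
  let l : V → V → ZMod p := fun x y =>
    ∑ i, ∑ j, if i < j then B.repr x i * B.repr y j * b (B i) (B j) else 0
  have hl1 : ∀ x y z, l (x + y) z = l x z + l y z := fun x y z => by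
    simp only [l, ← Finset.sum_add_distrib]
    refine Finset.sum_congr rfl fun i _ => Finset.sum_congr rfl fun j _ => ?_
    split_ifs
    · simp only [map_add, Finsupp.add_apply]
      ring
    · simp
  have hl2 : ∀ x y z, l x (y + z) = l x y + l x z := fun x y z => by
    simp only [l, ← Finset.sum_add_distrib]
    refine Finset.sum_congr rfl fun i _ => Finset.sum_congr rfl fun j _ => ?_
    split_ifs
    · simp only [map_add, Finsupp.add_apply]
      ring
    · simp
  have hl3 : ∀ x y, b x y = l x y + l y x + ∑ i, b (B i) (B i) * (B.repr x i * B.repr y i) := by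
    intro x y
    have h1 : l y x = ∑ i, ∑ j, if j < i then B.repr y j * B.repr x i * b (B j) (B i) else 0 :=
      Finset.sum_comm
    have h2 : ∑ i, b (B i) (B i) * (B.repr x i * B.repr y i) =
        ∑ i, ∑ j, if i = j then b (B i) (B i) * (B.repr x i * B.repr y i) else 0 := by
      simp
    rw [h1, h2]
    conv_lhs => rw [← B.sum_repr x, ← B.sum_repr y]
    simp only [l, ← Finset.sum_add_distrib, map_sum, LinearMap.sum_apply, map_smul,
      LinearMap.smul_apply, smul_eq_mul, Finset.mul_sum]
    rw [Finset.sum_comm]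
    refine Finset.sum_congr rfl fun i _ => Finset.sum_congr rfl fun j _ => ?_
    rcases lt_trichotomy i j with h | rfl | h
    · simp [h, h.not_gt, h.ne]; ring
    · simp; ring
    · simp [h, h.not_gt, h.ne', hb (B i) (B j)]; ring
  -- The phase of `l x x` has coboundary `l x y + l y x`. Each diagonal entry is handled by the
  -- power of `ψ` whose exponent is its integer representative.
  refine ⟨fun x => (∏ i, ψ (B.repr x i) ^ (b (B i) (B i)).val) * ZMod.stdAddChar (l x x),
    fun x => by simp [hψ1], fun x y => ?_⟩
  have h4 : ∀ i, ψ (B.repr (x + y) i) ^ (b (B i) (B i)).val =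
      ψ (B.repr x i) ^ (b (B i) (B i)).val * ψ (B.repr y i) ^ (b (B i) (B i)).val *
      ZMod.stdAddChar (b (B i) (B i) * (B.repr x i * B.repr y i)) := fun i => by
    rw [map_add, Finsupp.add_apply, hψ, mul_pow, mul_pow, ← AddChar.map_nsmul_eq_pow, nsmul_eq_mul,
      ZMod.natCast_zmod_val]
  have h5 : (ZMod.stdAddChar (∑ i, b (B i) (B i) * (B.repr x i * B.repr y i)) : ℂ) =
      ∏ i, ZMod.stdAddChar (b (B i) (B i) * (B.repr x i * B.repr y i)) :=
    map_prod (ZMod.stdAddChar (N := p)).toMonoidHom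
      (fun i => Multiplicative.ofAdd (b (B i) (B i) * (B.repr x i * B.repr y i))) Finset.univ
  simp only [h4, Finset.prod_mul_distrib, hl3 x y, hl1, hl2, AddChar.map_add_eq_mul, h5]
  ring

end Phase

/-! ### Error operators: products, traces, and spanning. -/

section ErrorOperators

variable (p : ℕ) [Fact p.Prime] {F : Type*} [Field F] [Algebra (ZMod p) F]

/-- Orthogonality of the characters of `F^ι`. -/
theorem sum_stdAddChar_trace [Fintype F] {ι : Type*} [Fintype ι] [DecidableEq ι] [DecidableEq F] (z : ι → F) :
    ∑ b : ι → F, (ZMod.stdAddChar (Algebra.trace (ZMod p) F (∑ i, b i * z i)) : ℂ) =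
      if z = 0 then (Fintype.card F : ℂ) ^ Fintype.card ι else 0 := by
  split_ifs with hz
  · simp [hz]
  · obtain ⟨j, hj⟩ := Function.ne_iff.1 hz
    obtain ⟨t, ht⟩ := exists_trace_mul_ne_zero p hj
    let f : (ι → F) →+ ZMod p :=
      { toFun := fun b => Algebra.trace (ZMod p) F (∑ i, b i * z i)
        map_zero' := by simp
        map_add' := fun a b => by
          rw [← map_add, ← Finset.sum_add_distrib]
          simp [add_mul] }
    refine AddChar.sum_eq_zero_of_ne_one (ψ := ZMod.stdAddChar.compAddMonoidHom f) fun h => ?_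
    have h1 := DFunLike.congr_fun h (Pi.single j t)
    rw [AddChar.one_apply, AddChar.compAddMonoidHom_apply,
      ← AddChar.map_zero_eq_one (ZMod.stdAddChar (N := p)),
      ZMod.injective_stdAddChar.eq_iff] at h1
    refine ht ?_
    rw [← h1]
    change _ = Algebra.trace (ZMod p) F (∑ i, Pi.single (M := fun _ => F) j t i * z i)
    rw [Finset.sum_eq_single j (fun i _ hi => by simp [hi]) (by simp)]
    simp [mul_comm]

variable {N : ℕ}

/-- The form `tr (b · u)` of `(a|b)` and `(u|v)`. -/
def mixedForm (F : Type*) [Field F] [Algebra (ZMod p) F] (N : ℕ) :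
    LinearMap.BilinForm (ZMod p) ((Fin N → F) × (Fin N → F)) :=
  LinearMap.mk₂ (ZMod p) (fun x y => Algebra.trace (ZMod p) F (∑ i, x.2 i * y.1 i))
    (fun x y z => by
      rw [← map_add, ← Finset.sum_add_distrib]
      simp [add_mul])
    (fun r x y => by
      rw [← map_smul, Finset.smul_sum]
      simp)
    (fun x y z => by
      rw [← map_add, ← Finset.sum_add_distrib]
      simp [mul_add])
    (fun r x y => by
      rw [← map_smul, Finset.smul_sum]
      simp)

theorem mixedForm_apply (x y : (Fin N → F) × (Fin N → F)) :
    mixedForm p F N x y = Algebra.trace (ZMod p) F (∑ i, x.2 i * y.1 i) := rfl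

/-- `mixedForm` is the cocycle of the products of error operators; its antisymmetrization governs
their commutation. Hence the cocycle is symmetric on a self-orthogonal code. -/
theorem traceForm_eq_mixedForm_sub (x y : (Fin N → F) × (Fin N → F)) :
    traceForm p F N x y = mixedForm p F N y x - mixedForm p F N x y := by
  simp only [traceForm_apply, traceSymp, mixedForm_apply, map_sum, map_sub,
    Finset.sum_sub_distrib]
  simp only [mul_comm]

/-- Extension of a function on a set of coordinates by zero. -/
def extendZero {F : Type*} [Zero F] (T : Finset (Fin N)) (a : T → F) : Fin N → F :=
  fun i => if h : i ∈ T then a ⟨i, h⟩ else 0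

theorem sum_extendZero_mul (T : Finset (Fin N)) (b : T → F) (y : Fin N → F) :
    ∑ i, extendZero T b i * y i = ∑ i : T, b i * y i := by
  rw [← Finset.sum_subset (Finset.subset_univ T) (fun i _ hi => by simp [extendZero, hi]),
    ← Finset.sum_coe_sort]
  exact Finset.sum_congr rfl fun i _ => by simp [extendZero]

variable [DecidableEq F]

/-- The error operator of a word `(a|b)`. -/
def wordOp (x : (Fin N → F) × (Fin N → F)) : Operator N F := errorOp p x.1 x.2

theorem wordOp_apply (x : (Fin N → F) × (Fin N → F)) (s t : Fin N → F) :
    wordOp p x s t = if s = t + x.1 then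
      (ZMod.stdAddChar (Algebra.trace (ZMod p) F (∑ i, x.2 i * t i)) : ℂ) else 0 := rfl

theorem wordOp_mul [Fintype F] (x y : (Fin N → F) × (Fin N → F)) :
    wordOp p x * wordOp p y =
      (ZMod.stdAddChar (mixedForm p F N x y) : ℂ) • wordOp p (x + y) := by
  ext s t
  rw [Matrix.mul_apply, Matrix.smul_apply, smul_eq_mul,
    Finset.sum_eq_single (t + y.1) (fun w _ hw => by rw [wordOp_apply p y, if_neg hw, mul_zero])
      (by simp), wordOp_apply p y, if_pos rfl, wordOp_apply, wordOp_apply, Prod.fst_add,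
    add_comm x.1, ← add_assoc]
  split_ifs
  · rw [← AddChar.map_add_eq_mul, ← AddChar.map_add_eq_mul, mixedForm_apply, ← map_add, ← map_add,
      ← Finset.sum_add_distrib, ← Finset.sum_add_distrib]
    congr 2
    refine Finset.sum_congr rfl fun i _ => ?_
    simp only [Pi.add_apply, Prod.snd_add]
    ring
  · simp

theorem wordOp_zero : wordOp p (0 : (Fin N → F) × (Fin N → F)) = 1 := by
  ext s t
  simp [wordOp_apply, Matrix.one_apply]

theorem wordOp_mul_comm [Fintype F] (x y : (Fin N → F) × (Fin N → F)) :
    wordOp p x * wordOp p y =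
      (ZMod.stdAddChar (traceForm p F N y x) : ℂ) • (wordOp p y * wordOp p x) := by
  rw [wordOp_mul, wordOp_mul, smul_smul, ← AddChar.map_add_eq_mul, traceForm_eq_mixedForm_sub,
    sub_add_cancel, add_comm y]

/-- A non-zero shift has zero diagonal; without a shift the trace is a character sum. -/
theorem trace_wordOp [Fintype F] (x : (Fin N → F) × (Fin N → F)) :
    (wordOp p x).trace = if x = 0 then (Fintype.card F : ℂ) ^ N else 0 := by
  simp only [Matrix.trace, Matrix.diag_apply, wordOp_apply, left_eq_add]
  by_cases h1 : x.1 = 0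
  · simp only [h1, if_true]
    have := sum_stdAddChar_trace p x.2
    simp only [mul_comm (x.2 _)]
    rw [this, Fintype.card_fin]
    refine if_congr ?_ rfl rfl
    rw [Prod.ext_iff]
    simp [h1]
  · have : x ≠ 0 := fun h => h1 (by simp [h])
    simp [h1, this]

theorem conjTranspose_mul_wordOp [Fintype F] (x : (Fin N → F) × (Fin N → F)) :
    (wordOp p x)ᴴ * wordOp p x = 1 := by
  ext s t
  rw [Matrix.mul_apply, Finset.sum_eq_single (t + x.1)
    (fun w _ hw => by rw [wordOp_apply p x w t, if_neg hw, mul_zero]) (by simp),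
    Matrix.conjTranspose_apply, wordOp_apply, wordOp_apply, if_pos rfl, Matrix.one_apply]
  by_cases h : s = t
  · subst h
    rw [if_pos rfl, if_pos rfl, ← starRingEnd_apply, ← AddChar.map_neg_eq_conj,
      ← AddChar.map_add_eq_mul]
    simp
  · rw [if_neg h, if_neg (fun h' => h (add_right_cancel h').symm)]
    simp

theorem swt_extendZero_le (T : Finset (Fin N)) (a b : T → F) :
    swt (extendZero T a, extendZero T b) ≤ T.card := by
  refine Finset.card_le_card fun i hi => ?_
  by_contra h
  simp [extendZero, h] at hi

/-- The set of factors is the one whose cardinality is `swt x`, so a bound on the weight can be fed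
directly to `DetectsBelow`. -/
theorem actsOn_wordOp (x : (Fin N → F) × (Fin N → F)) :
    ActsOn (Finset.univ.filter fun i => (x.1 i, x.2 i) ≠ (0, 0)) (wordOp p x) := by
  set T := Finset.univ.filter fun i => (x.1 i, x.2 i) ≠ (0, 0) with hT
  have hx : ∀ i, i ∉ T → x.1 i = 0 ∧ x.2 i = 0 := fun i hi => by simpa [hT] using hi
  refine ⟨Matrix.of fun s t => if s = t + (fun i : T => x.1 i) then
    (ZMod.stdAddChar (Algebra.trace (ZMod p) F (∑ i : T, x.2 i * t i)) : ℂ) else 0, fun s t => ?_⟩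
  have h2 : extendZero T (fun i : T => x.2 i) = x.2 := by
    ext i
    by_cases hi : i ∈ T
    · simp [extendZero, hi]
    · simp [extendZero, hi, (hx i hi).2]
  rw [wordOp_apply, Matrix.of_apply, ← sum_extendZero_mul T (fun i : T => x.2 i) t, h2, ← ite_and]
  refine if_congr ⟨fun h => ⟨fun i hi => by simp [h, (hx i hi).1], by rw [h]; rfl⟩, fun h => ?_⟩
    rfl rfl
  ext i
  by_cases hi : i ∈ T
  · exact congrFun h.2 ⟨i, hi⟩
  · simp [h.1 i hi, (hx i hi).1]

variable [Fintype F]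

/-- An operator acting on few tensor factors is a combination of error operators of small
weight. -/
theorem ActsOn.mem_span {T : Finset (Fin N)} {E : Operator N F} (hE : ActsOn T E) :
    E ∈ Submodule.span ℂ (wordOp p '' {x : (Fin N → F) × (Fin N → F) | swt x ≤ T.card}) := by
  obtain ⟨A, hA⟩ := hE
  -- For each shift `a`, these are the Fourier coefficients of the function `t ↦ A (t + a) t`.
  let f : (T → F) → (T → F) → ℂ := fun a b => ((Fintype.card F : ℂ) ^ T.card)⁻¹ *
    ∑ t : T → F, ZMod.stdAddChar (Algebra.trace (ZMod p) F (∑ i, b i * (-t i))) * A (t + a) t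
  have key : E = ∑ a : T → F, ∑ b : T → F,
      f a b • wordOp p (extendZero T a, extendZero T b) := by
    ext x y
    simp only [Matrix.sum_apply, Matrix.smul_apply, smul_eq_mul, wordOp_apply,
      sum_extendZero_mul]
    have hsum : ∀ a : T → F, ∑ b : T → F, f a b *
        (ZMod.stdAddChar (Algebra.trace (ZMod p) F (∑ i : T, b i * y i)) : ℂ) =
        A ((fun i : T => y i) + a) (fun i : T => y i) := fun a => by
      have hq : (Fintype.card F : ℂ) ^ T.card ≠ 0 := by simp
      have h1 : ∀ b t : T → F,
          (ZMod.stdAddChar (Algebra.trace (ZMod p) F (∑ i, b i * (-t i))) : ℂ) * A (t + a) t *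
            ZMod.stdAddChar (Algebra.trace (ZMod p) F (∑ i : T, b i * y i)) =
          A (t + a) t * ZMod.stdAddChar (Algebra.trace (ZMod p) F
            (∑ i : T, b i * ((fun i : T => y i) - t) i)) := fun b t => by
        rw [mul_right_comm, ← AddChar.map_add_eq_mul, ← map_add, ← Finset.sum_add_distrib, mul_comm]
        simp only [Pi.sub_apply, ← mul_add, neg_add_eq_sub]
      simp only [f, mul_assoc, Finset.sum_mul]
      simp only [← mul_assoc, h1]
      rw [← Finset.mul_sum, Finset.sum_comm]
      simp only [← Finset.mul_sum, sum_stdAddChar_trace, sub_eq_zero, Fintype.card_coe]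
      rw [Finset.sum_eq_single (fun i : T => y i) (fun t _ ht => by rw [if_neg ht.symm, mul_zero])
        (by simp), if_pos rfl, mul_comm (A _ _), inv_mul_cancel_left₀ hq]
    have hsum' : ∀ a : T → F, (∑ b : T → F, f a b * if x = y + extendZero T a then
        (ZMod.stdAddChar (Algebra.trace (ZMod p) F (∑ i : T, b i * y i)) : ℂ) else 0) =
        if x = y + extendZero T a then A ((fun i : T => y i) + a) (fun i : T => y i) else 0 := fun a => by
      split_ifs
      · exact hsum a
      · simp
    simp only [hsum']
    rw [hA]
    split_ifs with h
    · have h2 : x = y + extendZero T (fun i : T => x i - y i) := by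
        ext i
        by_cases hi : i ∈ T
        · simp [extendZero, hi]
        · simp [extendZero, hi, h i hi]
      rw [Finset.sum_eq_single (fun i : T => x i - y i) (fun a _ ha => if_neg fun h' => ha ?_)
        (by simp), if_pos h2]
      · congr 1
        ext i
        simp
      · ext i
        rw [h']
        simp [extendZero]
    · refine (Finset.sum_eq_zero fun a _ => if_neg fun h' => h fun i hi => ?_).symm
      rw [h']
      simp [extendZero, hi]
  rw [key]
  exact Submodule.sum_mem _ fun a _ => Submodule.sum_mem _ fun b _ => Submodule.smul_mem _ _
    (Submodule.subset_span ⟨_, swt_extendZero_le T a b, rfl⟩)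

end ErrorOperators

/-! ### Stabilizer codes of self-orthogonal codes. -/

section StabilizerCodes

open scoped ComplexOrder

variable {p : ℕ} [Fact p.Prime] {F : Type*} [Field F] [Fintype F] [DecidableEq F]
  [Algebra (ZMod p) F] {N : ℕ}

/-- A choice of phases that makes the error operators of a self-orthogonal code a group. -/
structure IsPhase (S : Submodule (ZMod p) ((Fin N → F) × (Fin N → F)))
    (c : (Fin N → F) × (Fin N → F) → ℂ) : Prop where
  norm_eq : ∀ x ∈ S, ‖c x‖ = 1
  map_add : ∀ x ∈ S, ∀ y ∈ S,
    c (x + y) = c x * c y * ZMod.stdAddChar (mixedForm p F N x y)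

omit [DecidableEq F] in
theorem exists_isPhase {S : Submodule (ZMod p) ((Fin N → F) × (Fin N → F))}
    (hS : S ≤ traceDual p S) : ∃ c, IsPhase S c := by
  classical
  obtain ⟨c, h1, h2⟩ := exists_phase_of_symm ((mixedForm p F N).restrict S) fun x y => by
    have := (mem_traceDual p).1 (hS y.2) x x.2
    rw [traceForm_eq_mixedForm_sub, sub_eq_zero] at this
    exact this.symm
  refine ⟨fun x => if h : x ∈ S then c ⟨x, h⟩ else 1, fun x hx => ?_, fun x hx y hy => ?_⟩
  · rw [dif_pos hx, h1]
  · rw [dif_pos hx, dif_pos hy, dif_pos (S.add_mem hx hy)]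
    exact h2 ⟨x, hx⟩ ⟨y, hy⟩

/-- The joint fixed space of the operators `c x • wordOp p x`, `x ∈ S`. -/
def stabCode (S : Submodule (ZMod p) ((Fin N → F) × (Fin N → F)))
    (c : (Fin N → F) × (Fin N → F) → ℂ) : Submodule ℂ (StateSpace N F) where
  carrier := {v | ∀ x ∈ S, (c x • wordOp p x) *ᵥ v = v}
  zero_mem' := fun _ _ => Matrix.mulVec_zero _
  add_mem' := fun hu hv x hx => by rw [Matrix.mulVec_add, hu x hx, hv x hx]
  smul_mem' := fun r v hv x hx => by rw [Matrix.mulVec_smul, hv x hx]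

variable {S : Submodule (ZMod p) ((Fin N → F) × (Fin N → F))}
  {c : (Fin N → F) × (Fin N → F) → ℂ}

omit [DecidableEq F] [Fintype F] in
theorem IsPhase.ne_zero (hc : IsPhase S c) {x : (Fin N → F) × (Fin N → F)} (hx : x ∈ S) :
    c x ≠ 0 := by
  rw [← norm_ne_zero_iff, hc.norm_eq x hx]
  exact one_ne_zero

omit [DecidableEq F] [Fintype F] in
theorem IsPhase.map_zero (hc : IsPhase S c) : c 0 = 1 := by
  have h := hc.map_add 0 S.zero_mem 0 S.zero_mem
  have h0 := hc.ne_zero S.zero_mem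
  rw [add_zero, LinearMap.map_zero, AddChar.map_zero_eq_one, mul_one] at h
  exact (mul_right_cancel₀ h0 ((one_mul _).trans h)).symm

theorem IsPhase.mul (hc : IsPhase S c) {x y : (Fin N → F) × (Fin N → F)} (hx : x ∈ S)
    (hy : y ∈ S) :
    (c x • wordOp p x) * (c y • wordOp p y) = c (x + y) • wordOp p (x + y) := by
  rw [smul_mul_smul_comm, wordOp_mul, smul_smul, hc.map_add x hx y hy]

theorem IsPhase.conjTranspose_mul (hc : IsPhase S c) {x : (Fin N → F) × (Fin N → F)}
    (hx : x ∈ S) : (c x • wordOp p x)ᴴ * (c x • wordOp p x) = 1 := by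
  rw [Matrix.conjTranspose_smul, smul_mul_smul_comm, conjTranspose_mul_wordOp,
    ← starRingEnd_apply, Complex.conj_mul', hc.norm_eq x hx]
  simp

/-- The stabilizer group, as a homomorphism from the self-orthogonal code. -/
def IsPhase.toHom (hc : IsPhase S c) : Multiplicative S →* Operator N F where
  toFun x := c x.toAdd • wordOp p (x.toAdd : (Fin N → F) × (Fin N → F))
  map_one' := by
    change c 0 • wordOp p 0 = 1
    rw [hc.map_zero, wordOp_zero, one_smul]
  map_mul' x y := (hc.mul x.toAdd.2 y.toAdd.2).symm

/-- The orthogonal projector onto the stabilizer code. -/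
def stabProj (S : Submodule (ZMod p) ((Fin N → F) × (Fin N → F)))
    (c : (Fin N → F) × (Fin N → F) → ℂ) : Operator N F :=
  (Nat.card S : ℂ)⁻¹ • ∑ᶠ x : S, c x • wordOp p (x : (Fin N → F) × (Fin N → F))

open Classical in
theorem stabProj_eq : stabProj S c =
    (Nat.card S : ℂ)⁻¹ • ∑ x : S, c x • wordOp p (x : (Fin N → F) × (Fin N → F)) := by
  rw [stabProj, finsum_eq_sum_of_fintype]

/-- Multiplication by a group element permutes the summands of the average, so the image is fixed;
on fixed vectors the average is the identity. -/
theorem IsPhase.isProj (hc : IsPhase S c) :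
    LinearMap.IsProj (stabCode S c) (Matrix.toLin' (stabProj S c)) := by
  classical
  refine ⟨fun v x hx => ?_, fun v hv => ?_⟩
  · rw [Matrix.toLin'_apply, Matrix.mulVec_mulVec]
    congr 1
    rw [stabProj_eq, Matrix.mul_smul, Finset.mul_sum]
    congr 1
    simp only [fun y : S => hc.mul hx y.2]
    exact Fintype.sum_equiv (Equiv.addLeft (⟨x, hx⟩ : S)) _
      (fun y : S => c y • wordOp p (y : (Fin N → F) × (Fin N → F))) fun y => rfl
  · rw [Matrix.toLin'_apply, stabProj_eq, Matrix.smul_mulVec, Matrix.sum_mulVec]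
    simp only [fun y : S => hv y y.2]
    have h0 : (Fintype.card S : ℂ) ≠ 0 := by simp
    simp [← Nat.cast_smul_eq_nsmul ℂ, smul_smul, h0]

theorem trace_wordOp_mul_stabProj {y : (Fin N → F) × (Fin N → F)}
    (hy : y ∉ S) : (wordOp p y * stabProj S c).trace = 0 := by
  classical
  rw [stabProj_eq, Matrix.mul_smul, Matrix.trace_smul, Finset.mul_sum, Matrix.trace_sum,
    Finset.sum_eq_zero, smul_zero]
  intro x _
  rw [Matrix.mul_smul, Matrix.trace_smul, wordOp_mul, Matrix.trace_smul, trace_wordOp, if_neg,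
    smul_zero, smul_zero]
  intro h
  exact hy (by rw [eq_neg_of_add_eq_zero_left h]; exact S.neg_mem x.2)

/-- The dimension is the trace of the projector, to which only the zero word contributes. -/
theorem IsPhase.finrank_mul_card (hc : IsPhase S c) :
    Module.finrank ℂ (stabCode S c) * Nat.card S = Fintype.card F ^ N := by
  classical
  have h1 := hc.isProj.trace
  rw [Matrix.trace_toLin'_eq, stabProj_eq, Matrix.trace_smul, Matrix.trace_sum,
    Finset.sum_eq_single (0 : S)] at h1
  · rw [Matrix.trace_smul, ZeroMemClass.coe_zero, trace_wordOp, if_pos rfl, hc.map_zero, one_smul,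
      smul_eq_mul] at h1
    have h0 : (Nat.card S : ℂ) ≠ 0 := by simp
    rw [inv_mul_eq_iff_eq_mul₀ h0] at h1
    rw [mul_comm]
    exact_mod_cast h1.symm
  · intro x _ hx
    rw [Matrix.trace_smul, trace_wordOp, if_neg (by simpa using hx), smul_zero]
  · simp

theorem IsPhase.finrank_pos (hc : IsPhase S c) : 0 < Module.finrank ℂ (stabCode S c) :=
  Nat.pos_of_ne_zero fun h => by
    have := hc.finrank_mul_card
    rw [h, zero_mul] at this
    exact (pow_ne_zero N Fintype.card_ne_zero) this.symm

theorem IsPhase.exists_mem_ne_zero (hc : IsPhase S c) : ∃ v ∈ stabCode S c, v ≠ 0 := by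
  have : stabCode S c ≠ ⊥ := fun h => by
    have := hc.finrank_pos
    rw [h, finrank_bot] at this
    exact this.false
  exact Submodule.exists_mem_ne_zero_of_ne_bot this

theorem IsPhase.isStabilizerCode (hc : IsPhase S c) : IsStabilizerCode p (stabCode S c) := by
  refine ⟨fun h => ?_, hc.toHom.toHomUnits.range, ?_, fun v => ⟨?_, fun h x hx => ?_⟩⟩
  · obtain ⟨v, hv, hv0⟩ := hc.exists_mem_ne_zero
    exact hv0 (by simpa [h] using hv)
  · rintro _ ⟨x, rfl⟩
    exact ⟨c x.toAdd, _, _, hc.norm_eq _ x.toAdd.2, rfl⟩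
  · rintro h _ ⟨x, rfl⟩
    exact h _ x.toAdd.2
  · exact h _ ⟨Multiplicative.ofAdd ⟨x, hx⟩, rfl⟩

theorem IsPhase.wordOp_mulVec (hc : IsPhase S c) {x : (Fin N → F) × (Fin N → F)} (hx : x ∈ S)
    {v : StateSpace N F} (hv : v ∈ stabCode S c) : wordOp p x *ᵥ v = (c x)⁻¹ • v := by
  have h := hv x hx
  rw [Matrix.smul_mulVec] at h
  rw [eq_inv_smul_iff₀ (hc.ne_zero hx), h]

theorem smul_wordOp_mul_comm (x y : (Fin N → F) × (Fin N → F)) (a : ℂ) :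
    wordOp p x * (a • wordOp p y) =
      (ZMod.stdAddChar (traceForm p F N y x) : ℂ) • ((a • wordOp p y) * wordOp p x) := by
  rw [Matrix.mul_smul, wordOp_mul_comm, Matrix.smul_mul, smul_comm]

theorem wordOp_mulVec_mem {x : (Fin N → F) × (Fin N → F)} (hx : x ∈ traceDual p S)
    {v : StateSpace N F} (hv : v ∈ stabCode S c) : wordOp p x *ᵥ v ∈ stabCode S c := by
  intro y hy
  have h := smul_wordOp_mul_comm (p := p) x y (c y)
  rw [(mem_traceDual p).1 hx y hy, AddChar.map_zero_eq_one, one_smul] at h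
  rw [Matrix.mulVec_mulVec, ← h, ← Matrix.mulVec_mulVec, hv y hy]

/-- Some unitary of the group fixes `u` and `v` and commutes with `wordOp p x` only up to a factor
other than one. Inserting it on both sides multiplies the inner product by that factor. -/
theorem IsPhase.dotProduct_eq_zero (hc : IsPhase S c) {x : (Fin N → F) × (Fin N → F)}
    (hx : x ∉ traceDual p S) {u v : StateSpace N F} (hu : u ∈ stabCode S c)
    (hv : v ∈ stabCode S c) : star u ⬝ᵥ (wordOp p x *ᵥ v) = 0 := by
  obtain ⟨y, hy, hyx⟩ : ∃ y ∈ S, traceForm p F N y x ≠ 0 := by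
    rw [mem_traceDual] at hx
    push Not at hx
    exact hx
  have h1 : (ZMod.stdAddChar (traceForm p F N y x) : ℂ) ≠ 1 := fun h => hyx <| by
    rwa [← AddChar.map_zero_eq_one (ZMod.stdAddChar (N := p)),
      ZMod.injective_stdAddChar.eq_iff] at h
  have h2 : star u ⬝ᵥ (wordOp p x *ᵥ v) =
      ZMod.stdAddChar (traceForm p F N y x) * star u ⬝ᵥ (wordOp p x *ᵥ v) := by
    conv_lhs => rw [← hu y hy, ← hv y hy]
    rw [Matrix.star_mulVec, ← Matrix.dotProduct_mulVec, Matrix.mulVec_mulVec,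
      Matrix.mulVec_mulVec, Matrix.mul_assoc, smul_wordOp_mul_comm, Matrix.mul_smul,
      ← Matrix.mul_assoc, hc.conjTranspose_mul hy, Matrix.one_mul, Matrix.smul_mulVec,
      dotProduct_smul, smul_eq_mul]
  by_contra hne
  exact h1 (mul_right_cancel₀ hne (by rw [one_mul, ← h2]))

/-- The operators that a code detects, or that have no effect on it. -/
def detectable (Q : Submodule ℂ (StateSpace N F)) : Submodule ℂ (Operator N F) where
  carrier := {E | ∃ c : ℂ, (∀ u ∈ Q, ∀ v ∈ Q, star u ⬝ᵥ (E *ᵥ v) = c * (star u ⬝ᵥ v)) ∧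
    (Module.finrank ℂ Q = 1 → c = E.trace / (Fintype.card F : ℂ) ^ N)}
  zero_mem' := ⟨0, by simp, by simp⟩
  add_mem' := by
    rintro E E' ⟨a, h1, h2⟩ ⟨b, h3, h4⟩
    refine ⟨a + b, fun u hu v hv => ?_, fun h => ?_⟩
    · rw [Matrix.add_mulVec, dotProduct_add, h1 u hu v hv, h3 u hu v hv, add_mul]
    · rw [h2 h, h4 h, Matrix.trace_add, add_div]
  smul_mem' := by
    rintro r E ⟨a, h1, h2⟩
    refine ⟨r * a, fun u hu v hv => ?_, fun h => ?_⟩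
    · rw [Matrix.smul_mulVec, dotProduct_smul, h1 u hu v hv, smul_eq_mul, mul_assoc]
    · rw [h2 h, Matrix.trace_smul, smul_eq_mul, mul_div_assoc]

variable {m : ℕ} (hF : Fintype.card F = p ^ m)

include hF in
theorem IsPhase.finrank_eq_pow (hc : IsPhase S c) {d : ℕ}
    (hd : d + Module.finrank (ZMod p) S = m * N) :
    Module.finrank ℂ (stabCode S c) = p ^ d := by
  have h := hc.finrank_mul_card
  rw [Module.natCard_eq_pow_finrank (K := ZMod p) (V := S), Nat.card_zmod, hF, ← pow_mul, ← hd,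
    pow_add] at h
  exact Nat.eq_of_mul_eq_mul_right (pow_pos (Fact.out : p.Prime).pos _) h

include hF in
theorem IsPhase.finrank_eq_one_iff (hS : S ≤ traceDual p S) (hc : IsPhase S c) :
    Module.finrank ℂ (stabCode S c) = 1 ↔ traceDual p S = S := by
  have h1 := finrank_traceDual p hF S
  have h2 := Submodule.finrank_mono hS
  obtain ⟨d, hd⟩ : ∃ d, d + Module.finrank (ZMod p) S = m * N :=
    ⟨m * N - Module.finrank (ZMod p) S, by omega⟩
  rw [hc.finrank_eq_pow hF hd, Nat.pow_eq_one]
  constructor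
  · intro h
    have : d = 0 := by
      have := (Fact.out : p.Prime).one_lt
      omega
    exact (Submodule.eq_of_le_of_finrank_eq hS (by omega)).symm
  · intro h
    rw [h] at h1
    right
    omega

include hF in
/-- A stabilizer code detects all errors of weight less than the weights of the words of the dual
code that are not in the code; if it is one-dimensional, the non-zero words of the code matter. -/
theorem IsPhase.detectsBelow (hS : S ≤ traceDual p S) (hc : IsPhase S c) {d : ℕ}
    (h1 : ∀ x ∈ traceDual p S, x ∉ S → d ≤ swt x)
    (h2 : traceDual p S = S → ∀ x ∈ S, x ≠ 0 → d ≤ swt x) :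
    DetectsBelow (stabCode S c) d := by
  intro T hT E hE
  suffices h : E ∈ detectable (stabCode S c) from h
  -- The detectable operators form a subspace, so error operators of small weight suffice.
  refine Submodule.span_le.2 ?_ (hE.mem_span p)
  rintro _ ⟨x, hx, rfl⟩
  have hxd : swt x < d := lt_of_le_of_lt hx hT
  by_cases hxS : x ∈ S
  · refine ⟨(c x)⁻¹, fun u hu v hv => ?_, fun h => ?_⟩
    · rw [hc.wordOp_mulVec hxS hv, dotProduct_smul, smul_eq_mul]
    · rw [hc.finrank_eq_one_iff hF hS] at h
      -- In dimension one the code is self-dual, and only the zero word is light enough. Its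
      -- operator is the identity, for which scalar and normalized trace are both one.
      have hx0 : x = 0 := by
        by_contra hne
        exact (h2 h x hxS hne).not_gt hxd
      rw [hx0, hc.map_zero, trace_wordOp, if_pos rfl, inv_one, div_self (by simp)]
  · have hxD : x ∉ traceDual p S := fun h => (h1 x h hxS).not_gt hxd
    refine ⟨0, fun u hu v hv => ?_, fun _ => ?_⟩
    · rw [hc.dotProduct_eq_zero hxD hu hv, zero_mul]
    · rw [trace_wordOp, if_neg (fun h => hxS (by rw [h]; exact S.zero_mem)), zero_div]

theorem IsPhase.not_detectsBelow_of_notMem (hc : IsPhase S c) {d : ℕ}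
    {x : (Fin N → F) × (Fin N → F)} (hx : x ∈ traceDual p S) (hxS : x ∉ S) (hd : swt x < d) :
    ¬ DetectsBelow (stabCode S c) d := by
  intro h
  obtain ⟨a, ha, -⟩ := h _ hd _ (actsOn_wordOp p x)
  -- The operator preserves the code, so the difference of the two sides lies in the code and is
  -- orthogonal to itself.
  have h1 : ∀ v ∈ stabCode S c, wordOp p x *ᵥ v = a • v := fun v hv => by
    have h2 : wordOp p x *ᵥ v - a • v ∈ stabCode S c :=
      Submodule.sub_mem _ (wordOp_mulVec_mem hx hv) (Submodule.smul_mem _ _ hv)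
    rw [← sub_eq_zero, ← dotProduct_star_self_eq_zero, dotProduct_sub, ha _ h2 v hv,
      dotProduct_smul, smul_eq_mul, sub_self]
  have h3 : wordOp p x * stabProj S c = a • stabProj S c := by
    apply Matrix.toLin'.injective
    refine LinearMap.ext fun v => ?_
    have := h1 _ (hc.isProj.map_mem v)
    rw [Matrix.toLin'_apply, Matrix.mulVec_mulVec] at this
    rw [Matrix.toLin'_apply, this, map_smul, LinearMap.smul_apply, Matrix.toLin'_apply]
  -- The trace forces `a = 0`, although `wordOp p x` is unitary and the code is non-zero.
  have h4 := trace_wordOp_mul_stabProj (c := c) hxS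
  rw [h3, Matrix.trace_smul, ← Matrix.trace_toLin'_eq, hc.isProj.trace, smul_eq_mul,
    mul_eq_zero, Nat.cast_eq_zero, or_iff_left hc.finrank_pos.ne'] at h4
  obtain ⟨v, hv, hv0⟩ := hc.exists_mem_ne_zero
  have h5 := h1 v hv
  rw [h4, zero_smul] at h5
  apply hv0
  rw [← Matrix.one_mulVec v, ← conjTranspose_mul_wordOp p x, ← Matrix.mulVec_mulVec, h5,
    Matrix.mulVec_zero]

-- The operator of `x` acts on the code as a non-zero scalar but is traceless, against the purity
-- required in dimension one.
include hF in
theorem IsPhase.not_detectsBelow_of_mem (hc : IsPhase S c) (hS : traceDual p S = S)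
    {d : ℕ} {x : (Fin N → F) × (Fin N → F)} (hx : x ∈ S) (hx0 : x ≠ 0) (hd : swt x < d) :
    ¬ DetectsBelow (stabCode S c) d := by
  intro h
  obtain ⟨a, ha, ha'⟩ := h _ hd _ (actsOn_wordOp p x)
  rw [trace_wordOp, if_neg hx0, zero_div] at ha'
  have h0 := ha' ((hc.finrank_eq_one_iff hF hS.ge).2 hS)
  obtain ⟨v, hv, hv0⟩ := hc.exists_mem_ne_zero
  have h1 := ha v hv v hv
  rw [hc.wordOp_mulVec hx hv, h0, zero_mul, dotProduct_smul, smul_eq_mul, mul_eq_zero,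
    or_iff_right (inv_ne_zero (hc.ne_zero hx)), dotProduct_star_self_eq_zero] at h1
  exact hv0 h1

end StabilizerCodes

/-! ### Bounds for the quantum minimum distance. -/

section Distance

variable {F : Type*} [Fintype F] [DecidableEq F] {N : ℕ}

theorem le_qDist {Q : Submodule ℂ (StateSpace N F)} {d : ℕ} (hd : d ≤ N)
    (h : DetectsBelow Q d) : d ≤ qDist Q :=
  le_csSup ⟨N, fun _ h => h.1⟩ ⟨hd, h⟩

theorem qDist_le_length (Q : Submodule ℂ (StateSpace N F)) : qDist Q ≤ N :=
  csSup_le ⟨0, Nat.zero_le _, fun _ h => absurd h (Nat.not_lt_zero _)⟩ fun _ h => h.1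

theorem qDist_le {Q : Submodule ℂ (StateSpace N F)} {w : ℕ}
    (h : ∀ d, w < d → ¬ DetectsBelow Q d) : qDist Q ≤ w :=
  csSup_le ⟨0, Nat.zero_le _, fun _ h => absurd h (Nat.not_lt_zero _)⟩ fun d hd =>
    not_lt.1 fun hlt => h d hlt hd.2

end Distance

/-! ### Existence of the anti-isometry and the Lagrangian. -/

section Extension

variable {p : ℕ} [Fact p.Prime] {F : Type*} [Field F] [Algebra (ZMod p) F] {n r : ℕ}

/-- The data of a self-orthogonal extension of a code `C`: an anti-isometry from `C` to words of
length `r` whose kernel is the radical of `C`, and a Lagrangian subspace of the orthogonal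
complement of its image. -/
structure IsAntiIsometry (C : Submodule (ZMod p) ((Fin n → F) × (Fin n → F)))
    (φ : C →ₗ[ZMod p] (Fin r → F) × (Fin r → F))
    (L : Submodule (ZMod p) ((Fin r → F) × (Fin r → F))) : Prop where
  form_eq : ∀ c c', traceForm p F r (φ c) (φ c') = -traceForm p F n c c'
  eq_zero : ∀ c : C, (c : (Fin n → F) × (Fin n → F)) ∈ traceDual p C → φ c = 0
  form_left : ∀ c, ∀ l ∈ L, traceForm p F r (φ c) l = 0
  form_self : ∀ l ∈ L, ∀ l' ∈ L, traceForm p F r l l' = 0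
  mem : ∀ y, (∀ c, traceForm p F r (φ c) y = 0) → (∀ l ∈ L, traceForm p F r l y = 0) → y ∈ L

theorem map_subtype_ker_restrict (C : Submodule (ZMod p) ((Fin n → F) × (Fin n → F))) :
    (LinearMap.ker ((traceForm p F n).restrict C)).map C.subtype = C ⊓ traceDual p C := by
  ext x
  simp only [Submodule.mem_map, LinearMap.mem_ker, Submodule.subtype_apply, Submodule.mem_inf,
    mem_traceDual]
  constructor
  · rintro ⟨y, hy, rfl⟩
    exact ⟨y.2, fun c hc => (traceForm_isAlt p).isRefl _ _ (LinearMap.congr_fun hy ⟨c, hc⟩)⟩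
  · rintro ⟨hx, h⟩
    exact ⟨⟨x, hx⟩, LinearMap.ext fun c =>
      (traceForm_isAlt p).isRefl (c : (Fin n → F) × (Fin n → F)) x (h c c.2), rfl⟩

theorem sum_append_mul_sub {K : Type*} [CommRing K] {e f : ℕ} (a b : Fin e → K) (s t : Fin f → K)
    (y : (Fin (e + f) → K) × (Fin (e + f) → K)) :
    ∑ i, (Fin.append a s i * y.2 i - Fin.append b t i * y.1 i) =
      ∑ i, (a i * y.2 (Fin.castAdd f i) - b i * y.1 (Fin.castAdd f i)) +
      ∑ i, (s i * y.2 (Fin.natAdd e i) - t i * y.1 (Fin.natAdd e i)) := by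
  rw [Fin.sum_univ_add]
  simp

variable [Fintype F]

theorem exists_isAntiIsometry {m : ℕ} (hF : Fintype.card F = p ^ m)
    (C : Submodule (ZMod p) ((Fin n → F) × (Fin n → F))) :
    ∃ e : ℕ, Module.finrank (ZMod p) C =
        Module.finrank (ZMod p) ↥(C ⊓ traceDual p C) + 2 * e ∧
      ∀ r f : ℕ, e + f = m * r → ∃ (φ : C →ₗ[ZMod p] (Fin r → F) × (Fin r → F))
        (L : Submodule (ZMod p) ((Fin r → F) × (Fin r → F))),
        IsAntiIsometry C φ L ∧ Module.finrank (ZMod p) L = f := by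
  have hB : ((traceForm p F n).restrict C).IsAlt :=
    fun x => traceForm_isAlt p (x : (Fin n → F) × (Fin n → F))
  obtain ⟨e, u, v, h, hk⟩ := exists_isHyperbolic hB
  refine ⟨e, ?_, fun r f hef => ?_⟩
  · rw [h.finrank_eq hk, ← map_subtype_ker_restrict, Submodule.finrank_map_subtype_eq,
      Fintype.card_fin]
  obtain ⟨e', u', v', h', hk'⟩ := exists_isHyperbolic (traceForm_isAlt p (F := F) (n := r))
  have hbot : LinearMap.ker (traceForm p F r) = ⊥ :=
    (LinearMap.BilinForm.nondegenerate_iff_ker_eq_bot).1 (traceForm_nondegenerate' p F r)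
  -- The form on words of length `r` is non-degenerate of dimension `2 * (m * r)`, so its pairs
  -- number `m * r`.
  obtain rfl : e' = e + f := by
    have := h'.finrank_eq hk'
    rw [hbot, finrank_bot, finrank_word p hF, Fintype.card_fin] at this
    omega
  have hsurj : ∀ y, hypComb u' v' (hypCoord (traceForm p F r) u' v' y) = y := fun y => by
    rw [hbot, LinearMap.ker_eq_bot] at hk'
    exact hk' (h'.coord_comb _)
  -- Exchanging the two halves of the coordinates reverses the sign of the form. The image uses the
  -- first `e` pairs.
  let ι : (Fin e → ZMod p) × (Fin e → ZMod p) →ₗ[ZMod p]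
      (Fin (e + f) → ZMod p) × (Fin (e + f) → ZMod p) :=
    { toFun := fun a => (Fin.append a.2 0, Fin.append a.1 0)
      map_add' := fun a b => by
        ext i <;> refine Fin.addCases (fun i => ?_) (fun i => ?_) i <;> simp
      map_smul' := fun t a => by
        ext i <;> refine Fin.addCases (fun i => ?_) (fun i => ?_) i <;> simp }
  -- `L` is spanned by the first members of the last `f` pairs.
  let κ : (Fin f → ZMod p) →ₗ[ZMod p] (Fin (e + f) → ZMod p) × (Fin (e + f) → ZMod p) :=
    { toFun := fun a => (Fin.append 0 a, Fin.append 0 0)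
      map_add' := fun a b => by
        ext i <;> refine Fin.addCases (fun i => ?_) (fun i => ?_) i <;> simp
      map_smul' := fun t a => by
        ext i <;> refine Fin.addCases (fun i => ?_) (fun i => ?_) i <;> simp }
  have hφ : ∀ a y, traceForm p F r (hypComb u' v' (ι a)) (hypComb u' v' y) =
      ∑ i, (a.2 i * y.2 (Fin.castAdd f i) - a.1 i * y.1 (Fin.castAdd f i)) := fun a y => by
    rw [h'.apply_comb (traceForm_isAlt p)]
    exact (sum_append_mul_sub _ _ _ _ _).trans (by simp)
  have hL : ∀ a y, traceForm p F r (hypComb u' v' (κ a)) (hypComb u' v' y) =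
      ∑ i, a i * y.2 (Fin.natAdd e i) := fun a y => by
    rw [h'.apply_comb (traceForm_isAlt p)]
    exact (sum_append_mul_sub _ _ _ _ _).trans (by simp)
  refine ⟨hypComb u' v' ∘ₗ ι ∘ₗ hypCoord ((traceForm p F n).restrict C) u v,
    LinearMap.range (hypComb u' v' ∘ₗ κ), ⟨fun c c' => ?_, fun c hc => ?_, ?_, ?_, ?_⟩, ?_⟩
  · have h1 := h.apply_eq hB hk c c'
    simp only [LinearMap.coe_comp, Function.comp_apply, hφ]
    change _ = -((traceForm p F n).restrict C c c')
    rw [h1, ← Finset.sum_neg_distrib]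
    exact Finset.sum_congr rfl fun i _ => by simp [ι]
  · have : c ∈ LinearMap.ker ((traceForm p F n).restrict C) :=
      LinearMap.ext fun c' => (traceForm_isAlt p).isRefl (c' : (Fin n → F) × (Fin n → F)) c
        (hc c' c'.2)
    rw [← hk, LinearMap.mem_ker] at this
    simp [this]
  · rintro c _ ⟨a, rfl⟩
    simp only [LinearMap.coe_comp, Function.comp_apply, hφ]
    simp [κ]
  · rintro _ ⟨a, rfl⟩ _ ⟨b, rfl⟩
    simp only [LinearMap.coe_comp, Function.comp_apply, hL]
    simp [κ]
  · intro y h1 h2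
    obtain ⟨y, rfl⟩ : ∃ b, hypComb u' v' b = y := ⟨_, hsurj y⟩
    have h3 : ∀ a, traceForm p F r (hypComb u' v' (ι a)) (hypComb u' v' y) = 0 := fun a => by
      obtain ⟨c, rfl⟩ := h.coord_surjective a
      exact h1 c
    have h4 : ∀ a, traceForm p F r (hypComb u' v' (κ a)) (hypComb u' v' y) = 0 := fun a =>
      h2 _ ⟨a, rfl⟩
    simp only [hφ, hL] at h3 h4
    -- Orthogonality to the image kills both coordinates at the first `e` pairs, and orthogonality
    -- to `L` kills the second ones at the last `f`.
    refine ⟨fun i => y.1 (Fin.natAdd e i), congrArg (hypComb u' v') ?_⟩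
    ext i <;> refine Fin.addCases (fun i => ?_) (fun i => ?_) i
    · simpa [κ, Pi.single_apply, eq_comm] using h3 (Pi.single i 1, 0)
    · simp [κ]
    · simpa [κ, Pi.single_apply, eq_comm] using h3 (0, Pi.single i 1)
    · simpa [κ, Pi.single_apply, eq_comm] using h4 (Pi.single i 1)
  · rw [LinearMap.finrank_range_of_inj, Module.finrank_fin_fun]
    refine h'.comb_injective.comp fun a b hab => ?_
    ext i
    have := congrFun (congrArg Prod.fst hab) (Fin.natAdd e i)
    simpa [κ] using this

end Extension

/-! ### Concatenation of words. -/

section Append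

variable {F : Type*} {n r : ℕ}

/-- Concatenation of words, position by position. -/
def wordAppend (x : (Fin n → F) × (Fin n → F)) (y : (Fin r → F) × (Fin r → F)) :
    (Fin (n + r) → F) × (Fin (n + r) → F) :=
  (Fin.append x.1 y.1, Fin.append x.2 y.2)

theorem exists_eq_wordAppend (z : (Fin (n + r) → F) × (Fin (n + r) → F)) :
    ∃ x y, z = wordAppend x y :=
  ⟨(fun i => z.1 (Fin.castAdd r i), fun i => z.2 (Fin.castAdd r i)),
    (fun i => z.1 (Fin.natAdd n i), fun i => z.2 (Fin.natAdd n i)),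
    Prod.ext Fin.append_castAdd_natAdd.symm Fin.append_castAdd_natAdd.symm⟩

theorem wordAppend_inj {x x' : (Fin n → F) × (Fin n → F)} {y y' : (Fin r → F) × (Fin r → F)} :
    wordAppend x y = wordAppend x' y' ↔ x = x' ∧ y = y' := by
  refine ⟨fun h => ⟨?_, ?_⟩, fun h => by rw [h.1, h.2]⟩
  · ext i
    · simpa [wordAppend] using congrFun (congrArg Prod.fst h) (Fin.castAdd r i)
    · simpa [wordAppend] using congrFun (congrArg Prod.snd h) (Fin.castAdd r i)
  · ext i
    · simpa [wordAppend] using congrFun (congrArg Prod.fst h) (Fin.natAdd n i)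
    · simpa [wordAppend] using congrFun (congrArg Prod.snd h) (Fin.natAdd n i)

variable [Field F]

theorem wordAppend_zero :
    wordAppend (0 : (Fin n → F) × (Fin n → F)) (0 : (Fin r → F) × (Fin r → F)) = 0 := by
  ext i <;> refine Fin.addCases (fun i => ?_) (fun i => ?_) i <;> simp [wordAppend]

theorem wordAppend_eq_zero {x : (Fin n → F) × (Fin n → F)} {y : (Fin r → F) × (Fin r → F)} :
    wordAppend x y = 0 ↔ x = 0 ∧ y = 0 := by
  rw [← wordAppend_zero, wordAppend_inj]

theorem wordAppend_add (x x' : (Fin n → F) × (Fin n → F)) (y y' : (Fin r → F) × (Fin r → F)) :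
    wordAppend (x + x') (y + y') = wordAppend x y + wordAppend x' y' := by
  ext i <;> refine Fin.addCases (fun i => ?_) (fun i => ?_) i <;> simp [wordAppend]

theorem wordAppend_smul {K : Type*} [Field K] [Algebra K F] (t : K) (x : (Fin n → F) × (Fin n → F))
    (y : (Fin r → F) × (Fin r → F)) :
    wordAppend (t • x) (t • y) = t • wordAppend x y := by
  ext i <;> refine Fin.addCases (fun i => ?_) (fun i => ?_) i <;> simp [wordAppend]

theorem traceForm_wordAppend (p : ℕ) [Fact p.Prime] [Algebra (ZMod p) F]
    (x x' : (Fin n → F) × (Fin n → F)) (y y' : (Fin r → F) × (Fin r → F)) :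
    traceForm p F (n + r) (wordAppend x y) (wordAppend x' y') =
      traceForm p F n x x' + traceForm p F r y y' := by
  simp only [traceForm_apply, traceSymp]
  rw [Fin.sum_univ_add]
  simp [wordAppend]

variable [DecidableEq F]

theorem swt_wordAppend (x : (Fin n → F) × (Fin n → F)) (y : (Fin r → F) × (Fin r → F)) :
    swt (wordAppend x y) = swt x + swt y := by
  simp only [swt, Finset.card_filter]
  rw [Fin.sum_univ_add]
  simp [wordAppend]

theorem swt_zero : swt (0 : (Fin n → F) × (Fin n → F)) = 0 := by
  simp [swt]

theorem swt_le (x : (Fin n → F) × (Fin n → F)) : swt x ≤ n :=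
  (Finset.card_filter_le _ _).trans (by simp)

theorem swt_pos {x : (Fin n → F) × (Fin n → F)} (hx : x ≠ 0) : 0 < swt x := by
  rw [swt, Finset.card_pos]
  by_contra h
  rw [Finset.not_nonempty_iff_eq_empty, Finset.filter_eq_empty_iff] at h
  refine hx ?_
  ext i
  · simpa using congrArg Prod.fst (not_not.1 (h (Finset.mem_univ i)))
  · simpa using congrArg Prod.snd (not_not.1 (h (Finset.mem_univ i)))

end Append

/-! ### The self-orthogonal extension and its dual. -/

section ExtendedCode

variable {p : ℕ} [Fact p.Prime] {F : Type*} [Field F] [Algebra (ZMod p) F] {n r : ℕ}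
  {C : Submodule (ZMod p) ((Fin n → F) × (Fin n → F))}
  {φ : C →ₗ[ZMod p] (Fin r → F) × (Fin r → F)}
  {L : Submodule (ZMod p) ((Fin r → F) × (Fin r → F))}

/-- The parametrization of the self-orthogonal extension of `C` by `φ` and `L`. -/
def extensionMap (φ : C →ₗ[ZMod p] (Fin r → F) × (Fin r → F))
    (L : Submodule (ZMod p) ((Fin r → F) × (Fin r → F))) :
    C × L →ₗ[ZMod p] (Fin (n + r) → F) × (Fin (n + r) → F) where
  toFun z := wordAppend z.1 (φ z.1 + z.2)
  map_add' z w := by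
    rw [← wordAppend_add]
    simp only [Prod.fst_add, Prod.snd_add, map_add, Submodule.coe_add, add_add_add_comm]
  map_smul' t z := by
    rw [RingHom.id_apply, ← wordAppend_smul]
    simp

/-- The self-orthogonal extension of `C` by `φ` and `L`. -/
def extendedCode (φ : C →ₗ[ZMod p] (Fin r → F) × (Fin r → F))
    (L : Submodule (ZMod p) ((Fin r → F) × (Fin r → F))) :
    Submodule (ZMod p) ((Fin (n + r) → F) × (Fin (n + r) → F)) :=
  LinearMap.range (extensionMap φ L)

theorem wordAppend_mem_extendedCode (c : C) {l : (Fin r → F) × (Fin r → F)} (hl : l ∈ L) :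
    wordAppend c (φ c + l) ∈ extendedCode φ L := ⟨(c, ⟨l, hl⟩), rfl⟩

theorem mem_extendedCode {z : (Fin (n + r) → F) × (Fin (n + r) → F)} :
    z ∈ extendedCode φ L ↔ ∃ c : C, ∃ l ∈ L, z = wordAppend c (φ c + l) := by
  constructor
  · rintro ⟨w, rfl⟩
    exact ⟨w.1, w.2, w.2.2, rfl⟩
  · rintro ⟨c, l, hl, rfl⟩
    exact wordAppend_mem_extendedCode c hl

theorem finrank_extendedCode [Fintype F] :
    Module.finrank (ZMod p) (extendedCode φ L) =
      Module.finrank (ZMod p) C + Module.finrank (ZMod p) L := by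
  rw [extendedCode, LinearMap.finrank_range_of_inj, Module.finrank_prod]
  intro z w h
  obtain ⟨h1, h2⟩ := wordAppend_inj.1 h
  have h3 : z.1 = w.1 := Subtype.ext h1
  rw [h3] at h2
  exact Prod.ext h3 (Subtype.ext (add_left_cancel h2))

theorem IsAntiIsometry.extendedCode_le (h : IsAntiIsometry C φ L) :
    extendedCode φ L ≤ traceDual p (extendedCode φ L) := by
  intro x hx y hy
  obtain ⟨c, l, hl, rfl⟩ := mem_extendedCode.1 hx
  obtain ⟨c', l', hl', rfl⟩ := mem_extendedCode.1 hy
  rw [← traceForm_apply, traceForm_wordAppend, map_add, map_add, LinearMap.add_apply,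
    LinearMap.add_apply, h.form_eq, h.form_left _ _ hl, h.form_self _ hl' _ hl,
    (traceForm_isAlt p).isRefl _ _ (h.form_left c l' hl')]
  ring

/-- `L` is orthogonal to the image of `φ`, and `φ` preserves the form up to sign. Thus a vanishing
tail `φ c + l` forces `c` into the radical. -/
theorem IsAntiIsometry.mem_dual_of_mem (h : IsAntiIsometry C φ L) {c : C} (hc : φ c ∈ L) :
    (c : (Fin n → F) × (Fin n → F)) ∈ traceDual p C := fun c' hc' => by
  have := h.form_left ⟨c', hc'⟩ _ hc
  rw [h.form_eq, neg_eq_zero] at this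
  exact this

theorem wordAppend_zero_mem_traceDual {d : (Fin n → F) × (Fin n → F)}
    (hd : d ∈ traceDual p C) : wordAppend d 0 ∈ traceDual p (extendedCode φ L) := by
  intro y hy
  obtain ⟨c, l, hl, rfl⟩ := mem_extendedCode.1 hy
  rw [← traceForm_apply, traceForm_wordAppend, (mem_traceDual p).1 hd c c.2]
  simp

theorem IsAntiIsometry.wordAppend_zero_mem_iff (h : IsAntiIsometry C φ L)
    {d : (Fin n → F) × (Fin n → F)} :
    wordAppend d 0 ∈ extendedCode φ L ↔ d ∈ C ⊓ traceDual p C := by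
  rw [mem_extendedCode]
  constructor
  · rintro ⟨c, l, hl, hz⟩
    obtain ⟨rfl, h2⟩ := wordAppend_inj.1 hz
    refine ⟨c.2, h.mem_dual_of_mem ?_⟩
    rw [eq_neg_of_add_eq_zero_left h2.symm]
    exact L.neg_mem hl
  · rintro ⟨hd, hd'⟩
    exact ⟨⟨d, hd⟩, 0, L.zero_mem, by rw [h.eq_zero ⟨d, hd⟩ hd', add_zero]⟩

variable [DecidableEq F]

/-- With `L` trivial the tail of a word is `φ c`: if it vanishes, `c` is in the radical, and
otherwise it adds at least one to the weight. -/
theorem IsAntiIsometry.swt_of_mem (h : IsAntiIsometry C φ L) (hL : L = ⊥)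
    {z : (Fin (n + r) → F) × (Fin (n + r) → F)} (hz : z ∈ extendedCode φ L) (hz' : z ≠ 0) :
    (∃ y ∈ traceDual p C, y ≠ 0 ∧ swt y ≤ swt z) ∨ ∃ y ∈ C, y ≠ 0 ∧ swt y + 1 ≤ swt z := by
  obtain ⟨c, l, hl, rfl⟩ := mem_extendedCode.1 hz
  rw [hL, Submodule.mem_bot] at hl
  rw [hl, add_zero] at hz' ⊢
  have hc0 : (c : (Fin n → F) × (Fin n → F)) ≠ 0 := fun h0 => hz' <| by
    have h1 : c = 0 := Subtype.ext h0
    rw [wordAppend_eq_zero, h1, map_zero]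
    exact ⟨rfl, rfl⟩
  rw [swt_wordAppend]
  by_cases h0 : φ c = 0
  · exact Or.inl ⟨c, h.mem_dual_of_mem (h0 ▸ L.zero_mem), hc0, Nat.le_add_right _ _⟩
  · exact Or.inr ⟨c, c.2, hc0, Nat.add_le_add_left (swt_pos h0) _⟩

variable [Fintype F]

-- Pairing with words `(c | 0)`, `c` in the radical, puts the head into the sum of `C` and its dual.
-- Once the head is split as `c + d`, the tail minus `φ c` is orthogonal to the image of `φ` and to
-- `L`, hence lies in `L`, which is maximal.
omit [DecidableEq F] in
theorem IsAntiIsometry.exists_of_mem_traceDual (h : IsAntiIsometry C φ L)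
    {z : (Fin (n + r) → F) × (Fin (n + r) → F)} (hz : z ∈ traceDual p (extendedCode φ L)) :
    ∃ c : C, ∃ d ∈ traceDual p C, ∃ l ∈ L, z = wordAppend ((c : (Fin n → F) × (Fin n → F)) + d) (φ c + l) := by
  obtain ⟨x, y, rfl⟩ := exists_eq_wordAppend z
  have h1 : ∀ c : C, ∀ l ∈ L, traceForm p F n c x + (traceForm p F r (φ c) y +
      traceForm p F r l y) = 0 := fun c l hl => by
    have := (mem_traceDual p).1 hz _ (wordAppend_mem_extendedCode c hl)
    rwa [traceForm_wordAppend, map_add, LinearMap.add_apply] at this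
  have h2 : ∀ c : C, traceForm p F n c x + traceForm p F r (φ c) y = 0 := fun c => by
    simpa using h1 c 0 L.zero_mem
  have h3 : ∀ l ∈ L, traceForm p F r l y = 0 := fun l hl => by
    simpa using h1 0 l hl
  have h4 : x ∈ C ⊔ traceDual p C := by
    rw [← traceDual_inf_traceDual]
    rintro c ⟨hc, hc'⟩
    have := h2 ⟨c, hc⟩
    rw [h.eq_zero ⟨c, hc⟩ hc', LinearMap.map_zero, LinearMap.zero_apply, add_zero] at this
    exact this
  obtain ⟨c, hc, d, hd, rfl⟩ := Submodule.mem_sup.1 h4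
  refine ⟨⟨c, hc⟩, d, hd, y - φ ⟨c, hc⟩, h.mem _ (fun c' => ?_) (fun l hl => ?_), ?_⟩
  · have := h2 c'
    rw [map_add, (mem_traceDual p).1 hd c' c'.2, add_zero] at this
    rw [map_sub, h.form_eq, sub_neg_eq_add, add_comm]
    exact this
  · rw [map_sub, h3 l hl, (traceForm_isAlt p).isRefl _ _ (h.form_left _ l hl), sub_zero]
  · rw [add_sub_cancel]

theorem IsAntiIsometry.swt_of_notMem (h : IsAntiIsometry C φ L)
    {z : (Fin (n + r) → F) × (Fin (n + r) → F)} (hz : z ∈ traceDual p (extendedCode φ L))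
    (hz' : z ∉ extendedCode φ L) :
    (∃ y ∈ traceDual p C, y ∉ C ∧ swt y ≤ swt z) ∨
      ∃ y ∈ C ⊔ traceDual p C, y ∉ C ∧ swt y + 1 ≤ swt z := by
  obtain ⟨c, d, hd, l, hl, rfl⟩ := h.exists_of_mem_traceDual hz
  have hdC : d ∉ C := fun hdC => hz' <| mem_extendedCode.2 ⟨c + ⟨d, hdC⟩, l, hl, by
    rw [map_add, h.eq_zero ⟨d, hdC⟩ hd, add_zero]; rfl⟩
  have hcd : (c + d : (Fin n → F) × (Fin n → F)) ∉ C := fun h' => hdC (by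
    simpa using C.sub_mem h' c.2)
  rw [swt_wordAppend]
  by_cases h0 : φ c + l = 0
  · have hc : (c : (Fin n → F) × (Fin n → F)) ∈ traceDual p C := h.mem_dual_of_mem (by
      rw [eq_neg_of_add_eq_zero_left h0]; exact L.neg_mem hl)
    exact Or.inl ⟨_, Submodule.add_mem _ hc hd, hcd, Nat.le_add_right _ _⟩
  · exact Or.inr ⟨_, Submodule.add_mem_sup c.2 hd, hcd, Nat.add_le_add_left (swt_pos h0) _⟩

end ExtendedCode

/-! ### Minimum weights and their default values. -/

section MinimumWeights

variable {F : Type*} [Field F] [DecidableEq F] {n : ℕ}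

theorem minSwt_le_swt {A : Set ((Fin n → F) × (Fin n → F))} {y : (Fin n → F) × (Fin n → F)}
    (hy : y ∈ A) (hy0 : y ≠ 0) : minSwt A ≤ swt y := by
  have h : y ∈ A \ {0} := ⟨hy, hy0⟩
  rw [minSwt, if_pos ⟨y, h⟩]
  exact Nat.sInf_le ⟨y, h, rfl⟩

theorem le_minSwt {A : Set ((Fin n → F) × (Fin n → F))} {d : ℕ} (hd : d ≤ n)
    (h : ∀ y ∈ A, y ≠ 0 → d ≤ swt y) : d ≤ minSwt A := by
  rw [minSwt]
  split_ifs with hA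
  · refine le_csInf (hA.image _) ?_
    rintro _ ⟨y, hy, rfl⟩
    exact h y hy.1 hy.2
  · exact hd

theorem minSwt_le_length (A : Set ((Fin n → F) × (Fin n → F))) : minSwt A ≤ n := by
  by_cases hA : (A \ {0}).Nonempty
  · obtain ⟨y, hy, hy0⟩ := hA
    exact (minSwt_le_swt hy hy0).trans (swt_le y)
  · rw [minSwt, if_neg hA]

theorem exists_swt_le_minSwt {A : Set ((Fin n → F) × (Fin n → F))} (hA : (A \ {0}).Nonempty) :
    ∃ y ∈ A, swt y ≤ minSwt A := by
  rw [minSwt, if_pos hA]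
  obtain ⟨y, hy, h⟩ := Nat.sInf_mem (hA.image swt)
  exact ⟨y, hy.1, h.le⟩

theorem symDist_le_swt {K : Type*} [Field K] [Algebra K F]
    {S : Submodule K ((Fin n → F) × (Fin n → F))} {y : (Fin n → F) × (Fin n → F)}
    (hy : y ∈ S) (hy0 : y ≠ 0) : symDist (S : Set ((Fin n → F) × (Fin n → F))) ≤ swt y := by
  rw [symDist, if_pos ⟨y, hy, 0, S.zero_mem, hy0⟩]
  exact Nat.sInf_le ⟨y, hy, 0, S.zero_mem, hy0, by rw [sub_zero]⟩

theorem symDist_le_length (A : Set ((Fin n → F) × (Fin n → F))) : symDist A ≤ n := by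
  rw [symDist]
  split_ifs with hA
  · obtain ⟨x, hx, y, hy, hxy⟩ := hA
    exact le_trans (b := swt (x - y)) (Nat.sInf_le ⟨x, hx, y, hy, hxy, rfl⟩) (swt_le _)
  · exact le_rfl

theorem symDist_le_minSwt_diff {K : Type*} [Field K] [Algebra K F]
    (S : Submodule K ((Fin n → F) × (Fin n → F))) (A : Set ((Fin n → F) × (Fin n → F))) :
    symDist (S : Set ((Fin n → F) × (Fin n → F))) ≤ minSwt ((S : Set _) \ A) :=
  le_minSwt (symDist_le_length _) fun _ hy hy0 => symDist_le_swt hy.1 hy0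

theorem swt_single_one (i : Fin n) :
    swt ((Pi.single i 1, 0) : (Fin n → F) × (Fin n → F)) = 1 := by
  rw [swt, Finset.card_eq_one]
  refine ⟨i, ?_⟩
  ext j
  by_cases h : j = i
  · subst h
    simp
  · simp [h]

omit [DecidableEq F] in
theorem single_one_ne_zero (i : Fin n) :
    ((Pi.single i 1, 0) : (Fin n → F) × (Fin n → F)) ≠ 0 := fun h => by
  simpa using congrFun (congrArg Prod.fst h) i

end MinimumWeights

/-! ### From the extension to the parameters of the quantum code. -/

section Bounds

theorem pos_of_card_eq {F : Type*} [Field F] [Fintype F] {p m : ℕ} (hF : Fintype.card F = p ^ m) : 0 < m := by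
  rcases Nat.eq_zero_or_pos m with rfl | h
  · have := Fintype.one_lt_card (α := F)
    rw [hF, pow_zero] at this
    exact absurd this (lt_irrefl 1)
  · exact h

theorem cast_pow_eq_rpow {F : Type*} [Field F] [Fintype F] {p m n : ℕ} (hF : Fintype.card F = p ^ m) {d k e : ℕ} (h : d + k = m * n + e) :
    ((p ^ d : ℕ) : ℝ) = (Fintype.card F : ℝ) ^ ((n : ℝ) - ((k : ℝ) - (e : ℝ)) / (m : ℝ)) := by
  have hm : (m : ℝ) ≠ 0 := by exact_mod_cast (pos_of_card_eq hF).ne'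
  have h' : (d : ℝ) + k = m * n + e := by exact_mod_cast h
  rw [hF, Nat.cast_pow, Nat.cast_pow, ← Real.rpow_natCast, ← Real.rpow_natCast,
    ← Real.rpow_mul (Nat.cast_nonneg p)]
  congr 1
  field_simp
  linarith

variable (p : ℕ) [Fact p.Prime] {F : Type*} [Field F] [Fintype F] [DecidableEq F]
  [Algebra (ZMod p) F] {n N m : ℕ}

/-- The code `Q` is a stabilizer code of dimension `q ^ (n - (k - e) / m)` whose distance meets
the bounds in terms of the additive code `C`. -/
structure MeetsBounds (m k e : ℕ) (C : Submodule (ZMod p) ((Fin n → F) × (Fin n → F)))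
    (Q : Submodule ℂ (StateSpace N F)) : Prop where
  isStabilizerCode : IsStabilizerCode p Q
  finrank_eq : (Module.finrank ℂ Q : ℝ) =
    (Fintype.card F : ℝ) ^ ((n : ℝ) - ((k : ℝ) - (e : ℝ)) / (m : ℝ))
  le_qDist : ¬ traceDual p C ≤ C →
    min (minSwt ((traceDual p C : Set ((Fin n → F) × (Fin n → F))) \
        ((C ⊓ traceDual p C : Submodule _ _) : Set _)))
      (minSwt (((C ⊔ traceDual p C : Submodule _ _) :
        Set ((Fin n → F) × (Fin n → F))) \ (C : Set _)) + 1) ≤ qDist Q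
  le_qDist_of_le : traceDual p C ≤ C → m ∣ e →
    min (symDist (traceDual p C : Set ((Fin n → F) × (Fin n → F))))
      (symDist ((C ⊔ traceDual p C : Submodule _ _) :
        Set ((Fin n → F) × (Fin n → F))) + 1) ≤ qDist Q
  qDist_le : qDist Q ≤ minSwt ((traceDual p C : Set ((Fin n → F) × (Fin n → F))) \
    ((C ⊓ traceDual p C : Submodule _ _) : Set _))

variable {p}

/-- The stabilizer code of the extension of an additive code meets the bounds, provided that the
extension has a word of small weight if it is self-dual. -/
theorem IsAntiIsometry.exists_meetsBounds (hF : Fintype.card F = p ^ m) {r e f : ℕ}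
    {C : Submodule (ZMod p) ((Fin n → F) × (Fin n → F))}
    {φ : C →ₗ[ZMod p] (Fin r → F) × (Fin r → F)}
    {L : Submodule (ZMod p) ((Fin r → F) × (Fin r → F))} (h : IsAntiIsometry C φ L)
    (hC : Module.finrank (ZMod p) C = Module.finrank (ZMod p) ↥(C ⊓ traceDual p C) + 2 * e)
    (hL : Module.finrank (ZMod p) L = f) (hef : e + f = m * r) (hf : m ∣ e → f = 0)
    (hsmall : traceDual p C ≤ C →
      n + r ≤ n ∨ ∃ x ∈ extendedCode φ L, x ≠ 0 ∧ swt x ≤ n) :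
    ∃ Q : Submodule ℂ (StateSpace (n + r) F),
      MeetsBounds p m (Module.finrank (ZMod p) C) e C Q := by
  have hS := h.extendedCode_le
  obtain ⟨c, hc⟩ := exists_isPhase hS
  have hdim := finrank_traceDual p hF (extendedCode φ L)
  have hle := Submodule.finrank_mono hS
  have hdimS : Module.finrank (ZMod p) (extendedCode φ L) = _ := finrank_extendedCode
  obtain ⟨d, hd⟩ : ∃ d, d + Module.finrank (ZMod p) (extendedCode φ L) = m * (n + r) :=
    ⟨m * (n + r) - Module.finrank (ZMod p) (extendedCode φ L), by omega⟩
  -- The words `(d | 0)` give one direction; conversely, a dual word outside the extension would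
  -- yield a word outside `C` in the dual of `C` or in its sum with `C`.
  have hdual : traceDual p (extendedCode φ L) = extendedCode φ L ↔ traceDual p C ≤ C := by
    constructor
    · intro h1 x hx
      have h2 := wordAppend_zero_mem_traceDual (φ := φ) (L := L) hx
      rw [h1, h.wordAppend_zero_mem_iff] at h2
      exact h2.1
    · intro h1
      refine le_antisymm (fun z hz => ?_) hS
      by_contra hz'
      rcases h.swt_of_notMem hz hz' with ⟨y, hy, hy', -⟩ | ⟨y, hy, hy', -⟩
      · exact hy' (h1 hy)
      · exact hy' (sup_le le_rfl h1 hy)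
  refine ⟨stabCode (extendedCode φ L) c, hc.isStabilizerCode, ?_, fun hCC => ?_,
    fun hCC hme => ?_, ?_⟩
  · rw [hc.finrank_eq_pow hF hd]
    refine cast_pow_eq_rpow hF ?_
    rw [mul_add] at hd
    omega
  · refine le_qDist ((min_le_left _ _).trans ((minSwt_le_length _).trans (Nat.le_add_right _ _)))
      (hc.detectsBelow hF hS (fun z hz hz' => ?_) fun h1 => absurd (hdual.1 h1) hCC)
    rcases h.swt_of_notMem hz hz' with ⟨y, hy, hy', hyz⟩ | ⟨y, hy, hy', hyz⟩
    · refine min_le_of_left_le (le_trans (minSwt_le_swt ⟨hy, fun h' => hy' h'.1⟩ ?_) hyz)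
      rintro rfl
      exact hy' C.zero_mem
    · have hy2 : y ∈ ((C ⊔ traceDual p C : Submodule _ _) : Set ((Fin n → F) × (Fin n → F))) \
          (C : Set _) := ⟨hy, hy'⟩
      refine min_le_of_right_le
        (le_trans (Nat.add_le_add_right (minSwt_le_swt hy2 ?_) 1) hyz)
      rintro rfl
      exact hy' C.zero_mem
  · have hL0 : L = ⊥ := by
      rw [← Submodule.finrank_eq_zero (R := ZMod p), hL, hf hme]
    refine le_qDist ((min_le_left _ _).trans ((symDist_le_length _).trans (Nat.le_add_right _ _)))
      (hc.detectsBelow hF hS (fun z hz hz' => absurd ((hdual.2 hCC).le hz) hz')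
        fun _ z hz hz0 => ?_)
    rcases h.swt_of_mem hL0 hz hz0 with ⟨y, hy, hy0, hyz⟩ | ⟨y, hy, hy0, hyz⟩
    · exact (min_le_left _ _).trans ((symDist_le_swt hy hy0).trans hyz)
    · exact (min_le_right _ _).trans
        ((Nat.add_le_add_right (symDist_le_swt (Submodule.mem_sup_left hy) hy0) 1).trans hyz)
  · by_cases hCC : traceDual p C ≤ C
    -- The difference is empty here, so the bound is the default `n`, and `hsmall` has to supply a
    -- reason for it.
    · have hempty : minSwt ((traceDual p C : Set ((Fin n → F) × (Fin n → F))) \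
          ((C ⊓ traceDual p C : Submodule _ _) : Set _)) = n := by
        rw [minSwt, if_neg]
        rintro ⟨y, ⟨hy, hy'⟩, -⟩
        exact hy' ⟨hCC hy, hy⟩
      rw [hempty]
      rcases hsmall hCC with hr | ⟨x, hx, hx0, hxn⟩
      · exact (qDist_le_length _).trans hr
      · exact qDist_le fun d hd =>
          hc.not_detectsBelow_of_mem hF (hdual.2 hCC) hx hx0 (hxn.trans_lt hd)
    · obtain ⟨x, hx, hxC⟩ := Set.not_subset.1 hCC
      obtain ⟨y, ⟨hy, hy'⟩, hyw⟩ := exists_swt_le_minSwt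
        (A := (traceDual p C : Set ((Fin n → F) × (Fin n → F))) \
          ((C ⊓ traceDual p C : Submodule _ _) : Set _))
        ⟨x, ⟨hx, fun h' => hxC h'.1⟩, by rintro rfl; exact hxC C.zero_mem⟩
      refine qDist_le fun d hd => hc.not_detectsBelow_of_notMem
        (wordAppend_zero_mem_traceDual hy) (fun h' => hy' (h.wordAppend_zero_mem_iff.1 h')) ?_
      rw [swt_wordAppend, swt_zero, add_zero]
      exact hyw.trans_lt hd

end Bounds

/-! ### The exceptional case: `C` is the full space. -/

section FullSpace

variable {p : ℕ} [Fact p.Prime] {F : Type*} [Field F] [Algebra (ZMod p) F] {n N m : ℕ}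

/-- The anti-isometry `(a|b) ↦ (a|-b)`. -/
def conjWord (p : ℕ) [Fact p.Prime] (F : Type*) [Field F] [Algebra (ZMod p) F] (n : ℕ) :
    (Fin n → F) × (Fin n → F) →ₗ[ZMod p] (Fin n → F) × (Fin n → F) :=
  LinearMap.id.prodMap (-LinearMap.id)

theorem conjWord_apply (x : (Fin n → F) × (Fin n → F)) : conjWord p F n x = (x.1, -x.2) := rfl

theorem traceForm_conjWord (x y : (Fin n → F) × (Fin n → F)) :
    traceForm p F n (conjWord p F n x) (conjWord p F n y) = -traceForm p F n x y := by
  simp only [traceForm_apply, traceSymp, conjWord_apply, ← Finset.sum_neg_distrib, ← map_neg]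
  refine Finset.sum_congr rfl fun i _ => congrArg _ ?_
  simp only [Pi.neg_apply]
  ring

theorem conjWord_conjWord (x : (Fin n → F) × (Fin n → F)) :
    conjWord p F n (conjWord p F n x) = x := by
  simp [conjWord_apply]

variable [Fintype F]

variable (p) in
theorem eq_zero_of_forall_traceForm {y : (Fin n → F) × (Fin n → F)}
    (h : ∀ x, traceForm p F n x y = 0) : y = 0 :=
  (traceForm_nondegenerate' p F n).2 y h

theorem isAntiIsometry_conjWord :
    IsAntiIsometry (⊤ : Submodule (ZMod p) ((Fin n → F) × (Fin n → F)))
      (conjWord p F n ∘ₗ Submodule.subtype _) ⊥ where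
  form_eq c c' := traceForm_conjWord _ _
  eq_zero c hc := by
    have : (c : (Fin n → F) × (Fin n → F)) = 0 :=
      eq_zero_of_forall_traceForm p fun x => hc x trivial
    rw [LinearMap.comp_apply, Submodule.subtype_apply, this, map_zero]
  form_left c l hl := by rw [(Submodule.mem_bot _).1 hl, map_zero]
  form_self l hl l' hl' := by rw [(Submodule.mem_bot _).1 hl', map_zero]
  mem y hy _ := by
    rw [Submodule.mem_bot]
    refine eq_zero_of_forall_traceForm p fun x => ?_
    have := hy ⟨conjWord p F n x, trivial⟩
    rwa [LinearMap.comp_apply, Submodule.subtype_apply, conjWord_conjWord] at this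

/-- The self-dual code of the words `(a|0)`. -/
def shiftCode (p : ℕ) [Fact p.Prime] (F : Type*) [Field F] [Algebra (ZMod p) F] (N : ℕ) :
    Submodule (ZMod p) ((Fin N → F) × (Fin N → F)) :=
  LinearMap.ker (LinearMap.snd (ZMod p) (Fin N → F) (Fin N → F))

theorem traceDual_shiftCode : traceDual p (shiftCode p F N) = shiftCode p F N := by
  apply le_antisymm
  · intro x hx
    change x.2 = 0
    ext j
    by_contra hne
    obtain ⟨b, hb⟩ := exists_trace_mul_ne_zero p hne
    refine hb ?_
    rw [← hx (Pi.single j b, 0) rfl, traceSymp,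
      Finset.sum_eq_single j (fun i _ hi => by simp [hi]) (by simp)]
    simp [mul_comm]
  · intro x hx y hy
    have hx' : x.2 = 0 := hx
    have hy' : y.2 = 0 := hy
    simp [traceSymp, hx', hy']

variable [DecidableEq F]

/-- For `n = 1` the graph of an anti-isometry has minimum weight two, above the default value `n`. A
self-dual code with words of weight one replaces it; the lower bound only asks for distance one. -/
theorem exists_meetsBounds_top_of_length_one (hF : Fintype.card F = p ^ m) :
    ∃ Q : Submodule ℂ (StateSpace (1 + 1) F),
      MeetsBounds p m (2 * m) m (⊤ : Submodule (ZMod p) ((Fin 1 → F) × (Fin 1 → F))) Q := by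
  have hS := traceDual_shiftCode (p := p) (F := F) (N := 1 + 1)
  obtain ⟨c, hc⟩ := exists_isPhase hS.ge
  refine ⟨stabCode _ c, hc.isStabilizerCode, ?_, fun h => absurd le_top h, fun _ _ => ?_, ?_⟩
  · rw [(hc.finrank_eq_one_iff hF hS.ge).2 hS, ← pow_zero p]
    exact cast_pow_eq_rpow hF (by ring)
  · refine (min_le_left _ _).trans ((symDist_le_length _).trans (le_qDist (by norm_num) ?_))
    exact hc.detectsBelow hF hS.ge (fun x hx hx' => absurd (hS.le hx) hx')
      fun _ x _ hx0 => swt_pos hx0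
  · rw [minSwt, if_neg]
    · refine qDist_le fun d hd => hc.not_detectsBelow_of_mem hF hS (x := (Pi.single 0 1, 0)) rfl
        (single_one_ne_zero _) ?_
      rwa [swt_single_one]
    · rintro ⟨y, ⟨hy, hy'⟩, -⟩
      exact hy' ⟨trivial, hy⟩

/-- `conjWord` preserves weights, so a word of weight one extends to one of weight two, which is at
most `n` once `n ≥ 2`. -/
theorem exists_meetsBounds_top (hF : Fintype.card F = p ^ m) :
    ∃ Q : Submodule ℂ (StateSpace (n + n) F),
      MeetsBounds p m (2 * (m * n)) (m * n)
        (⊤ : Submodule (ZMod p) ((Fin n → F) × (Fin n → F))) Q := by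
  by_cases hn : n = 1
  · subst hn
    rw [mul_one]
    exact exists_meetsBounds_top_of_length_one hF
  have hfin := finrank_word p hF (n := n)
  have hbot : traceDual p (⊤ : Submodule (ZMod p) ((Fin n → F) × (Fin n → F))) = ⊥ :=
    (Submodule.eq_bot_iff _).2 fun x hx => eq_zero_of_forall_traceForm p fun y => hx y trivial
  have := isAntiIsometry_conjWord (p := p) (F := F) (n := n)
  rw [← hfin, ← finrank_top (ZMod p) ((Fin n → F) × (Fin n → F))]
  refine this.exists_meetsBounds hF ?_ (finrank_bot _ _) rfl (fun _ => rfl) fun _ => ?_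
  · rw [hbot, inf_bot_eq, finrank_bot, finrank_top, hfin, zero_add]
  · rcases Nat.eq_zero_or_pos n with rfl | hpos
    · exact Or.inl le_rfl
    · refine Or.inr ⟨_, wordAppend_mem_extendedCode
        ⟨(Pi.single ⟨0, hpos⟩ 1, 0), Submodule.mem_top⟩
        (Submodule.zero_mem _), fun h0 => ?_, ?_⟩
      · exact single_one_ne_zero _ (wordAppend_eq_zero.1 h0).1
      · rw [swt_wordAppend, add_zero, LinearMap.comp_apply, Submodule.subtype_apply,
          conjWord_apply, neg_zero, swt_single_one]
        omega

end FullSpace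

/-! ### Existence for every additive code. -/

section Existence

variable {p : ℕ} [Fact p.Prime] {F : Type*} [Field F] [Fintype F] [DecidableEq F]
  [Algebra (ZMod p) F] {n m : ℕ}

theorem exists_meetsBounds (hF : Fintype.card F = p ^ m)
    (C : Submodule (ZMod p) ((Fin n → F) × (Fin n → F))) :
    ∃ e : ℕ, Module.finrank (ZMod p) C =
        Module.finrank (ZMod p) ↥(C ⊓ traceDual p C) + 2 * e ∧
      ∀ r f : ℕ, e + f = m * r → r ≤ n → (m ∣ e → f = 0) →
        ∃ Q : Submodule ℂ (StateSpace (n + r) F),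
          MeetsBounds p m (Module.finrank (ZMod p) C) e C Q := by
  obtain ⟨e, he, hφ⟩ := exists_isAntiIsometry hF C
  refine ⟨e, he, fun r f hef hr hf => ?_⟩
  obtain ⟨φ, L, h, hL⟩ := hφ r f hef
  -- Exactly in this case neither the dual of `C` nor `L` offers a short word of the extension, and
  -- `φ` has to be chosen explicitly or the extension abandoned.
  by_cases hcase : traceDual p C = ⊥ ∧ f = 0
  · obtain ⟨hbot, rfl⟩ := hcase
    have htop : C = ⊤ := by
      rw [← traceDual_traceDual p C, hbot, eq_top_iff]
      intro x _ c hc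
      rw [← traceForm_apply, (Submodule.mem_bot _).1 hc, LinearMap.map_zero,
        LinearMap.zero_apply]
    rw [htop, finrank_top, finrank_word p hF, ← htop, hbot, inf_bot_eq, finrank_bot] at he
    have he' : e = m * n := by omega
    have hrn : r = n := Nat.eq_of_mul_eq_mul_left (pos_of_card_eq hF) (by omega)
    subst hrn
    rw [htop, finrank_top, finrank_word p hF, he']
    exact exists_meetsBounds_top hF
  · refine h.exists_meetsBounds hF he hL hef hf fun hCC => Or.inr ?_
    by_cases hf0 : f = 0
    · obtain ⟨x, hx, hx0⟩ := Submodule.exists_mem_ne_zero_of_ne_bot fun hb => hcase ⟨hb, hf0⟩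
      exact ⟨wordAppend x 0, h.wordAppend_zero_mem_iff.2 ⟨hCC hx, hx⟩,
        fun h0 => hx0 (wordAppend_eq_zero.1 h0).1, by
          rw [swt_wordAppend, swt_zero, add_zero]; exact swt_le x⟩
    · obtain ⟨l, hl, hl0⟩ : ∃ l ∈ L, l ≠ 0 := Submodule.exists_mem_ne_zero_of_ne_bot fun hb => by
        rw [hb, finrank_bot] at hL
        exact hf0 hL.symm
      refine ⟨_, wordAppend_mem_extendedCode (φ := φ) 0 hl, fun h0 => ?_, ?_⟩
      · have := (wordAppend_eq_zero.1 h0).2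
        rw [map_zero, zero_add] at this
        exact hl0 this
      · rw [swt_wordAppend, map_zero, zero_add, ZeroMemClass.coe_zero, swt_zero, zero_add]
        exact (swt_le l).trans hr

end Existence

end TraceSymp

end

theorem mainTheorem6 (p m n k : ℕ) [Fact p.Prime]
    (F : Type*) [Field F] [Fintype F] [DecidableEq F] [Algebra (ZMod p) F]
    (hF : Fintype.card F = p ^ m)
    (C : Submodule (ZMod p) ((Fin n → F) × (Fin n → F)))
    (hC : Nat.card C = p ^ k) :
    ∃ e : ℕ,
      k = Module.finrank (ZMod p) ↥(C ⊓ TraceSymp.traceDual p C) + 2 * e ∧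
      ∃ Q : Submodule ℂ (TraceSymp.StateSpace (n + ⌈(e : ℚ) / (m : ℚ)⌉₊) F),
        TraceSymp.IsStabilizerCode p Q ∧
        (Module.finrank ℂ Q : ℝ) =
          (Fintype.card F : ℝ) ^ ((n : ℝ) - ((k : ℝ) - (e : ℝ)) / (m : ℝ)) ∧
        (¬ TraceSymp.traceDual p C ≤ C →
          min
            (TraceSymp.minSwt ((TraceSymp.traceDual p C : Set ((Fin n → F) × (Fin n → F))) \
              ((C ⊓ TraceSymp.traceDual p C : Submodule _ _) : Set _)))
            (TraceSymp.minSwt (((C ⊔ TraceSymp.traceDual p C : Submodule _ _) :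
              Set ((Fin n → F) × (Fin n → F))) \ (C : Set _)) + 1)
          ≤ TraceSymp.qDist Q) ∧
        min
            (TraceSymp.symDist (TraceSymp.traceDual p C : Set ((Fin n → F) × (Fin n → F))))
            (TraceSymp.symDist ((C ⊔ TraceSymp.traceDual p C : Submodule _ _) :
              Set ((Fin n → F) × (Fin n → F))) + 1)
          ≤ min
            (TraceSymp.minSwt ((TraceSymp.traceDual p C : Set ((Fin n → F) × (Fin n → F))) \
              ((C ⊓ TraceSymp.traceDual p C : Submodule _ _) : Set _)))
            (TraceSymp.minSwt (((C ⊔ TraceSymp.traceDual p C : Submodule _ _) :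
              Set ((Fin n → F) × (Fin n → F))) \ (C : Set _)) + 1) ∧
        (TraceSymp.traceDual p C ≤ C → m ∣ e →
          min
            (TraceSymp.symDist (TraceSymp.traceDual p C : Set ((Fin n → F) × (Fin n → F))))
            (TraceSymp.symDist ((C ⊔ TraceSymp.traceDual p C : Submodule _ _) :
              Set ((Fin n → F) × (Fin n → F))) + 1)
          ≤ TraceSymp.qDist Q) ∧
        TraceSymp.qDist Q ≤
          TraceSymp.minSwt ((TraceSymp.traceDual p C : Set ((Fin n → F) × (Fin n → F))) \
            ((C ⊓ TraceSymp.traceDual p C : Submodule _ _) : Set _)) := by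
  have hk : Module.finrank (ZMod p) C = k := by
    rw [Module.natCard_eq_pow_finrank (K := ZMod p) (V := C), Nat.card_zmod] at hC
    exact Nat.pow_right_injective (Fact.out : p.Prime).two_le hC
  have hm : 0 < m := TraceSymp.pos_of_card_eq hF
  have hm' : (0 : ℚ) < m := by exact_mod_cast hm
  obtain ⟨e, he, hQ⟩ := TraceSymp.exists_meetsBounds hF C
  -- `2 * e` is at most the dimension of `C`, hence of the whole space. This gives `⌈e/m⌉ ≤ n`,
  -- which bounds the weight of the words of `L`.
  have hen : e ≤ m * n := by
    have h1 := Submodule.finrank_le C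
    rw [TraceSymp.finrank_word p hF] at h1
    omega
  have hr : e ≤ m * ⌈(e : ℚ) / (m : ℚ)⌉₊ := by
    have h1 := Nat.le_ceil ((e : ℚ) / (m : ℚ))
    rw [div_le_iff₀ hm', mul_comm] at h1
    exact_mod_cast h1
  have hrn : ⌈(e : ℚ) / (m : ℚ)⌉₊ ≤ n := by
    rw [Nat.ceil_le, div_le_iff₀ hm', mul_comm]
    exact_mod_cast hen
  have hdvd : m ∣ e → m * ⌈(e : ℚ) / (m : ℚ)⌉₊ - e = 0 := by
    rintro ⟨t, rfl⟩
    rw [Nat.cast_mul, mul_div_cancel_left₀ _ hm'.ne', Nat.ceil_natCast, Nat.sub_self]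
  -- Here `r = ⌈e/m⌉` and `f = m * r - e`, so that `L` is trivial when `m` divides `e`.
  obtain ⟨Q, h⟩ := hQ _ _ (Nat.add_sub_cancel' hr) hrn hdvd
  rw [hk] at h he
  exact ⟨e, he, Q, h.isStabilizerCode, h.finrank_eq, h.le_qDist,
    min_le_min (TraceSymp.symDist_le_minSwt_diff _ _)
      (Nat.add_le_add_right (TraceSymp.symDist_le_minSwt_diff _ _) 1),
    h.le_qDist_of_le, h.qDist_le⟩
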